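/- Let $m\ge 8$ and $r\ge 1$ be integers, let $d_1,\dots,d_m$ be natural numbers, $D=\sum_{i=1}^m d_i$ and $d=D/m$. Write $\mathcal O_{n,r}=\{O\in\mathbb R^{n\times r}: O^TO=I_r\}$, let $\Theta_i\in\mathcal O_{d_i,r}$ for $i=1,\dots,m$ (so $d_i\ge r$), and let $\Theta\in\mathbb R^{D\times r}$ be the matrix with blocks $\Theta_1,\dots,\Theta_m$. Let $\|\cdot\|$ be the operator norm and $\|\cdot\|_F$ the Frobenius norm; for $X\in\mathbb R^{D\times D}$ let $X_{ij}\in\mathbb R^{d_i\times d_j}$ be its $(i,j)$ block, and for $Y\in\mathbb R^{D\times r}$ let $[Y]_i\in\mathbb R^{d_i\times r}$ be its $i$-th block. A matrix $X\in\mathbb R^{D\times D}$ is called $\Theta$-discordant if it is symmetric, $\|X\|\le 3\sqrt D$, and $\max_{1\le i\le m}\|[X\Theta]_i\|_F\le 3\sqrt{Dr\log m}$. Let $W\in\mathbb R^{D\times D}$ and $\sigma>0$ be such that $\sigma^{-1}W$ is $\Theta$-discordant and $$\sigma\le\frac{m^{1/4}}{60\sqrt{dr}}.$$ Let $S\in\mathbb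 R^{D\times D}$ be the matrix with blocks $S_{ij}=\Theta_i\Theta_j^T+W_{ij}$, $1\le i,j\le m$. Consider the problems (OTSM) maximize $\sum_{i,j=1}^m\operatorname{tr}(O_i^TS_{ij}O_j)$ over $O_i\in\mathcal O_{d_i,r}$, $i=1,\dots,m$; (SDP) maximize $\langle S,U\rangle=\operatorname{tr}(S^TU)$ over symmetric $U\in\mathbb R^{D\times D}$ with $U\succcurlyeq 0$, and $U_{ii}\preccurlyeq I$, $\operatorname{tr}(U_{ii})=r$ for all $i$; (R) maximize $\operatorname{tr}(SU)$ over the $U$ feasible for (SDP) with $\operatorname{rank}(U)=r$. Put $A=\max_{1\le i\le m}\|[W\Theta]_i\|_F+4\|W\|^2\sqrt{r/m}$. Then $m>\|W\|(4\sqrt r+1)+1$ and $$m>4m\,\frac{2A}{m-\|W\|(4\sqrt r+1)-1}+2A+8\|W\|\sqrt{\frac rm}+2\|W\|,$$ and the solutions of (OTSM) and (SDP) are equivalent: a matrix $U\in\mathbb R^{D\times D}$ solves (SDP) if and only if it solves (R), and if and only if $U=OO^T$ for some solution $(O_1,\dots,O_m)$ of (OTSM), where $O\in\mathbb R^{D\times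 r}$ is the matrix with blocks $O_1,\dots,O_m$. -/

import Mathlib

open scoped Matrix

namespace OTSM

/-- Row (and column) indices of a matrix of order `D = d 0 + ⋯ + d (m - 1)` that is partitioned
into `m` groups of sizes `d 0, …, d (m - 1)`: a group `i`, and an index inside that group. -/
abbrev Idx {m : ℕ} (d : Fin m → ℕ) : Type := (i : Fin m) × Fin (d i)

/-- The operator norm of a real square matrix, induced by the Euclidean norm. -/
noncomputable def opNorm {n : Type} [Fintype n] [DecidableEq n] (A : Matrix n n ℝ) : ℝ :=
  ‖Matrix.toEuclideanCLM (n := n) (𝕜 := ℝ) A‖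

/-- The Frobenius norm of a real matrix. -/
noncomputable def frobNorm {k l : Type} [Fintype k] [Fintype l] (A : Matrix k l ℝ) : ℝ :=
  √(∑ i, ∑ j, A i j ^ 2)

/-- The `(i, j)` block `X_{ij}`, of size `d i × d j`. -/
def block {m : ℕ} {d : Fin m → ℕ} (X : Matrix (Idx d) (Idx d) ℝ) (i j : Fin m) :
    Matrix (Fin (d i)) (Fin (d j)) ℝ :=
  Matrix.of fun a b => X ⟨i, a⟩ ⟨j, b⟩

/-- The `i`-th block `Y_i`, of size `d i × r`, of a `D × r` matrix. -/
def rowBlock {m r : ℕ} {d : Fin m → ℕ} (Y : Matrix (Idx d) (Fin r) ℝ) (i : Fin m) :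
    Matrix (Fin (d i)) (Fin r) ℝ :=
  Matrix.of fun a k => Y ⟨i, a⟩ k

/-- The `D × r` matrix whose blocks are the given `O 0, …, O (m - 1)`. -/
def stack {m r : ℕ} {d : Fin m → ℕ} (O : (i : Fin m) → Matrix (Fin (d i)) (Fin r) ℝ) :
    Matrix (Idx d) (Fin r) ℝ :=
  Matrix.of fun p k => O p.1 p.2 k

/-- The Stiefel manifold of `n × r` matrices `A` with `Aᵀ A = I`. -/
def stiefel (n r : ℕ) : Set (Matrix (Fin n) (Fin r) ℝ) := {A | Aᵀ * A = 1}

/-- `Θ`-discordance of a matrix `W`. -/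
structure IsDiscordant {m r : ℕ} {d : Fin m → ℕ}
    (Θ : (i : Fin m) → Matrix (Fin (d i)) (Fin r) ℝ) (W : Matrix (Idx d) (Idx d) ℝ) : Prop where
  symm : W.IsSymm
  opNorm_le : opNorm W ≤ 3 * √((∑ i, d i : ℕ) : ℝ)
  sup_frobNorm_le : ⨆ i, frobNorm (rowBlock (W * stack Θ) i) ≤
    3 * √(((∑ i, d i : ℕ) : ℝ) * r * Real.log m)

/-- The data matrix `S`, with blocks `S_{ij} = Θ_i Θ_jᵀ + W_{ij}` (all `i`, `j`). -/
def dataMatrix {m r : ℕ} {d : Fin m → ℕ}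
    (Θ : (i : Fin m) → Matrix (Fin (d i)) (Fin r) ℝ) (W : Matrix (Idx d) (Idx d) ℝ) :
    Matrix (Idx d) (Idx d) ℝ :=
  Matrix.of fun p q => (Θ p.1 * (Θ q.1)ᵀ + block W p.1 q.1) p.2 q.2

/-- The orthogonal trace-sum objective. -/
def traceSum {m r : ℕ} {d : Fin m → ℕ} (S : Matrix (Idx d) (Idx d) ℝ)
    (O : (i : Fin m) → Matrix (Fin (d i)) (Fin r) ℝ) : ℝ :=
  ∑ i, ∑ j, ((O i)ᵀ * block S i j * O j).trace

/-- `O` is a (global) solution of the orthogonal trace-sum maximization problem for `S`. -/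
def IsTraceSumSolution {m r : ℕ} {d : Fin m → ℕ} (S : Matrix (Idx d) (Idx d) ℝ)
    (O : (i : Fin m) → Matrix (Fin (d i)) (Fin r) ℝ) : Prop :=
  (∀ i, O i ∈ stiefel (d i) r) ∧
    ∀ O' : (i : Fin m) → Matrix (Fin (d i)) (Fin r) ℝ,
      (∀ i, O' i ∈ stiefel (d i) r) → traceSum S O' ≤ traceSum S O

/-- The feasible set of the semidefinite relaxation: `U = Uᵀ`, `U ≽ 0`, and `U_{ii} ≼ I`,
`tr U_{ii} = r` for every `i`. -/
def sdpFeasible {m : ℕ} (d : Fin m → ℕ) (r : ℕ) : Set (Matrix (Idx d) (Idx d) ℝ) :=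
  {U | U.IsSymm ∧ U.PosSemidef ∧
    ∀ i, (1 - block U i i).PosSemidef ∧ (block U i i).trace = r}

/-- `U` is a solution of the semidefinite relaxation: it maximizes `⟨S, U⟩ = tr (Sᵀ U)` over
the feasible set. -/
def IsSDPSolution {m : ℕ} {d : Fin m → ℕ} (r : ℕ) (S U : Matrix (Idx d) (Idx d) ℝ) : Prop :=
  U ∈ sdpFeasible d r ∧ ∀ U' ∈ sdpFeasible d r, (Sᵀ * U').trace ≤ (Sᵀ * U).trace

/-- `U` is a solution of the lifted form of the trace-sum problem: it maximizes `tr (S U)` over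
the matrices of rank exactly `r` that are feasible for the semidefinite relaxation. -/
def IsRankSolution {m : ℕ} {d : Fin m → ℕ} (r : ℕ) (S U : Matrix (Idx d) (Idx d) ℝ) : Prop :=
  (U ∈ sdpFeasible d r ∧ U.rank = r) ∧
    ∀ U' ∈ sdpFeasible d r, U'.rank = r → (S * U').trace ≤ (S * U).trace

/-- `max_i ‖[W Θ]_i‖_F + 4 ‖W‖² √(r / m)`. -/
noncomputable def noiseTerm {m r : ℕ} {d : Fin m → ℕ}
    (Θ : (i : Fin m) → Matrix (Fin (d i)) (Fin r) ℝ) (W : Matrix (Idx d) (Idx d) ℝ) : ℝ :=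
  (⨆ i, frobNorm (rowBlock (W * stack Θ) i)) + 4 * opNorm W ^ 2 * √((r : ℝ) / m)

/-- The deterministic smallness condition on the noise `W`. The first conjunct says that the
denominator in the second one is positive. -/
def NoiseCondition {m r : ℕ} {d : Fin m → ℕ}
    (Θ : (i : Fin m) → Matrix (Fin (d i)) (Fin r) ℝ) (W : Matrix (Idx d) (Idx d) ℝ) : Prop :=
  opNorm W * (4 * √(r : ℝ) + 1) + 1 < (m : ℝ) ∧
  4 * (m : ℝ) * (2 * noiseTerm Θ W / ((m : ℝ) - opNorm W * (4 * √(r : ℝ) + 1) - 1))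
    + 2 * noiseTerm Θ W + 8 * opNorm W * √((r : ℝ) / m) + 2 * opNorm W < (m : ℝ)

end OTSM

/-!
Multiplying all blocks on the right by one orthogonal matrix changes neither `O Oᵀ` nor the
objective, so a solution `O` of the trace-sum problem can be aligned with `Θ`: `Θᵀ O ≽ 0`.
Comparing the values of the objective at `O` and at `Θ` gives `‖O - Θ‖_F ≤ 4 ‖W‖ √(r / m)`, and
replacing a single block `O_i` by `Θ_i` gives
`‖O_i - Θ_i‖_F ≤ 2 A / (m - ‖W‖ (4 √r + 1) - 1)`, where `A` is `noiseTerm Θ W`. Optimality of each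
block yields `[S O]_i = O_i Λ_i` with `Λ_i` symmetric, and the block estimate shows that `Λ_i` is
close to `m I`. Hence `Λ_i ≽ t I` for some `t` that exceeds the quadratic form of `S` on the unit
vectors orthogonal to the columns of `O`. The block diagonal matrix with blocks
`O_i (Λ_i - t I) O_iᵀ + t I` is then a dual certificate for `O Oᵀ`, strict enough to make `O Oᵀ`
the only solution of the semidefinite relaxation.

For discordant noise everything is compared with powers of `u = m^{1/4}`: `‖W‖ √r` is at most
`u ^ 3 / 20` and `max_i ‖[W Θ]_i‖_F` at most `0.043 u ^ 4`.
-/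

namespace OTSM

section Frobenius

variable {k l n : Type} [Fintype k] [Fintype l] [Fintype n]

lemma frobNorm_nonneg (A : Matrix k l ℝ) : 0 ≤ frobNorm A := Real.sqrt_nonneg _

lemma sq_frobNorm (A : Matrix k l ℝ) : frobNorm A ^ 2 = ∑ i, ∑ j, A i j ^ 2 :=
  Real.sq_sqrt (by positivity)

lemma trace_transpose_mul (A B : Matrix k l ℝ) :
    (Aᵀ * B).trace = ∑ i, ∑ j, A i j * B i j := by
  simp only [Matrix.trace, Matrix.diag_apply, Matrix.mul_apply, Matrix.transpose_apply]
  exact Finset.sum_comm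

lemma trace_transpose_mul_self (A : Matrix k l ℝ) : (Aᵀ * A).trace = frobNorm A ^ 2 := by
  rw [sq_frobNorm, trace_transpose_mul]
  simp only [sq]

lemma trace_transpose_mul_comm (A B : Matrix k l ℝ) : (Aᵀ * B).trace = (Bᵀ * A).trace := by
  simp only [trace_transpose_mul, mul_comm]

lemma trace_mul_mul_transpose (S : Matrix k k ℝ) (X : Matrix k l ℝ) :
    (S * (X * Xᵀ)).trace = (Xᵀ * (S * X)).trace := by
  rw [← Matrix.mul_assoc, Matrix.trace_mul_comm]

lemma trace_transpose_mul_mul_add {S : Matrix k k ℝ} (hS : S.IsSymm) (V E : Matrix k l ℝ) :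
    ((V + E)ᵀ * (S * (V + E))).trace =
      (Vᵀ * (S * V)).trace + 2 * (Eᵀ * (S * V)).trace + (Eᵀ * (S * E)).trace := by
  have hcross : (Vᵀ * (S * E)).trace = (Eᵀ * (S * V)).trace := by
    rw [trace_transpose_mul_comm, Matrix.transpose_mul, hS.eq, Matrix.mul_assoc]
  simp only [Matrix.transpose_add, Matrix.add_mul, Matrix.mul_add, Matrix.trace_add, hcross]
  ring

lemma trace_transpose_mul_mul_add_of_mul_eq_zero {T : Matrix k k ℝ} (hT : T.IsSymm)
    {V : Matrix k n ℝ} (hTV : T * V = 0) (Y : Matrix n l ℝ) (Z : Matrix k l ℝ) :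
    ((V * Y + Z)ᵀ * (T * (V * Y + Z))).trace = (Zᵀ * (T * Z)).trace := by
  have hVT : Vᵀ * T = 0 := by
    rw [← hT.eq, ← Matrix.transpose_mul, hTV, Matrix.transpose_zero]
  rw [Matrix.mul_add, ← Matrix.mul_assoc T, hTV, Matrix.zero_mul, zero_add,
    Matrix.transpose_add, Matrix.add_mul, Matrix.transpose_mul, Matrix.mul_assoc,
    ← Matrix.mul_assoc Vᵀ, hVT, Matrix.zero_mul, Matrix.mul_zero, zero_add]

lemma abs_trace_transpose_mul_le (A B : Matrix k l ℝ) :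
    |(Aᵀ * B).trace| ≤ frobNorm A * frobNorm B := by
  apply abs_le_of_sq_le_sq _ (mul_nonneg (frobNorm_nonneg A) (frobNorm_nonneg B))
  rw [mul_pow, sq_frobNorm, sq_frobNorm, trace_transpose_mul]
  simp only [← Fintype.sum_prod_type']
  exact Finset.sum_mul_sq_le_sq_mul_sq _ _ _

lemma trace_transpose_mul_le (A B : Matrix k l ℝ) :
    (Aᵀ * B).trace ≤ frobNorm A * frobNorm B :=
  (le_abs_self _).trans (abs_trace_transpose_mul_le A B)

open scoped Matrix.Norms.Frobenius in
lemma frobNorm_eq_norm (A : Matrix k l ℝ) : frobNorm A = ‖A‖ := by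
  rw [Matrix.frobenius_norm_def, frobNorm, Real.sqrt_eq_rpow]
  simp

open scoped Matrix.Norms.Frobenius in
lemma frobNorm_add_le (A B : Matrix k l ℝ) : frobNorm (A + B) ≤ frobNorm A + frobNorm B := by
  simpa only [frobNorm_eq_norm] using norm_add_le A B

open scoped Matrix.Norms.Frobenius in
lemma frobNorm_sub_le (A B : Matrix k l ℝ) : frobNorm (A - B) ≤ frobNorm A + frobNorm B := by
  simpa only [frobNorm_eq_norm] using norm_sub_le A B

open scoped Matrix.Norms.Frobenius in
lemma frobNorm_sub_rev (A B : Matrix k l ℝ) : frobNorm (A - B) = frobNorm (B - A) := by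
  simpa only [frobNorm_eq_norm] using norm_sub_rev A B

open scoped Matrix.Norms.Frobenius in
lemma frobNorm_mul_le (A : Matrix k l ℝ) (B : Matrix l n ℝ) :
    frobNorm (A * B) ≤ frobNorm A * frobNorm B := by
  simpa only [frobNorm_eq_norm] using Matrix.frobenius_norm_mul A B

open scoped Matrix.Norms.Frobenius in
lemma frobNorm_smul (c : ℝ) (A : Matrix k l ℝ) : frobNorm (c • A) = |c| * frobNorm A := by
  rw [frobNorm_eq_norm, frobNorm_eq_norm, norm_smul, Real.norm_eq_abs]

open scoped Matrix.Norms.Frobenius in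
lemma frobNorm_transpose (A : Matrix k l ℝ) : frobNorm Aᵀ = frobNorm A := by
  simpa only [frobNorm_eq_norm] using Matrix.frobenius_norm_transpose A

open scoped Matrix.Norms.Frobenius in
lemma frobNorm_eq_zero {A : Matrix k l ℝ} : frobNorm A = 0 ↔ A = 0 := by
  rw [frobNorm_eq_norm, norm_eq_zero]

end Frobenius

section OperatorNorm

variable {k l : Type} [Fintype k] [Fintype l] [DecidableEq k]

lemma opNorm_nonneg (W : Matrix k k ℝ) : 0 ≤ opNorm W := norm_nonneg _

lemma opNorm_smul (c : ℝ) (W : Matrix k k ℝ) : opNorm (c • W) = |c| * opNorm W := by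
  rw [opNorm, map_smul, norm_smul, Real.norm_eq_abs, opNorm]

lemma sum_sq_mulVec_le (W : Matrix k k ℝ) (x : k → ℝ) :
    ∑ i, (W *ᵥ x) i ^ 2 ≤ opNorm W ^ 2 * ∑ i, x i ^ 2 := by
  have h := pow_le_pow_left₀ (norm_nonneg _)
    ((Matrix.toEuclideanCLM (n := k) (𝕜 := ℝ) W).le_opNorm (WithLp.toLp 2 x)) 2
  rw [mul_pow, EuclideanSpace.norm_sq_eq, EuclideanSpace.norm_sq_eq] at h
  simpa [opNorm] using h

lemma frobNorm_mul_le_opNorm_mul (W : Matrix k k ℝ) (X : Matrix k l ℝ) :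
    frobNorm (W * X) ≤ opNorm W * frobNorm X := by
  refine (abs_le_of_sq_le_sq' ?_ (mul_nonneg (opNorm_nonneg W) (frobNorm_nonneg X))).2
  rw [mul_pow, ← frobNorm_transpose, ← frobNorm_transpose X, sq_frobNorm, sq_frobNorm,
    Finset.mul_sum]
  exact Finset.sum_le_sum fun j _ => sum_sq_mulVec_le W fun i => X i j

lemma abs_trace_transpose_mul_mul_le (W : Matrix k k ℝ) (X Y : Matrix k l ℝ) :
    |(Xᵀ * (W * Y)).trace| ≤ opNorm W * frobNorm X * frobNorm Y :=
  calc |(Xᵀ * (W * Y)).trace| ≤ frobNorm X * frobNorm (W * Y) := abs_trace_transpose_mul_le _ _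
    _ ≤ frobNorm X * (opNorm W * frobNorm Y) :=
      mul_le_mul_of_nonneg_left (frobNorm_mul_le_opNorm_mul W Y) (frobNorm_nonneg X)
    _ = opNorm W * frobNorm X * frobNorm Y := by ring

lemma trace_transpose_mul_mul_le (W : Matrix k k ℝ) (X Y : Matrix k l ℝ) :
    (Xᵀ * (W * Y)).trace ≤ opNorm W * frobNorm X * frobNorm Y :=
  (le_abs_self _).trans (abs_trace_transpose_mul_mul_le W X Y)

lemma trace_transpose_mul_mul_sub_le {W : Matrix k k ℝ} (hW : W.IsSymm) (T V : Matrix k l ℝ) :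
    (Vᵀ * (W * V)).trace - (Tᵀ * (W * T)).trace ≤
      opNorm W * frobNorm (V - T) * (frobNorm V + frobNorm T) := by
  have hfactor : (Vᵀ * (W * V)).trace - (Tᵀ * (W * T)).trace =
      ((V - T)ᵀ * (W * (V + T))).trace := by
    have hexpand := trace_transpose_mul_mul_add hW T (V - T)
    rw [add_sub_cancel] at hexpand
    rw [hexpand, show V + T = (V - T) + (T + T) by abel]
    simp only [Matrix.mul_add, Matrix.trace_add]
    ring
  rw [hfactor]
  exact (trace_transpose_mul_mul_le W _ _).trans (mul_le_mul_of_nonneg_left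
    (frobNorm_add_le V T) (mul_nonneg (opNorm_nonneg W) (frobNorm_nonneg _)))

end OperatorNorm

section PosSemidef

variable {k l : Type} [Fintype l]

lemma posSemidef_mul_transpose_self [Finite k] (X : Matrix k l ℝ) : (X * Xᵀ).PosSemidef := by
  simpa using Matrix.posSemidef_self_mul_conjTranspose X

variable [Fintype k]

open scoped MatrixOrder Matrix.Norms.L2Operator in
lemma exists_eq_mul_transpose {U : Matrix k k ℝ} (hU : U.PosSemidef) :
    ∃ X : Matrix k k ℝ, U = X * Xᵀ := by
  classical
  obtain ⟨B, hB⟩ := (CStarAlgebra.nonneg_iff_eq_star_mul_self (a := U)).1 hU.nonneg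
  exact ⟨Bᵀ, by simpa [Matrix.star_eq_conjTranspose] using hB⟩

lemma trace_transpose_mul_mul_nonneg {M : Matrix k k ℝ} (hM : M.PosSemidef)
    (X : Matrix k l ℝ) : 0 ≤ (Xᵀ * (M * X)).trace := by
  simpa [Matrix.mul_assoc] using (hM.conjTranspose_mul_mul_same X).trace_nonneg

lemma trace_mul_nonneg {M N : Matrix k k ℝ} (hM : M.PosSemidef) (hN : N.PosSemidef) :
    0 ≤ (M * N).trace := by
  obtain ⟨X, rfl⟩ := exists_eq_mul_transpose hN
  rw [← Matrix.mul_assoc, Matrix.trace_mul_comm]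
  exact trace_transpose_mul_mul_nonneg hM X

lemma posSemidef_of_trace_nonneg {M : Matrix k k ℝ} (hM : M.IsSymm)
    (h : ∀ X : Matrix k Unit ℝ, 0 ≤ (Xᵀ * (M * X)).trace) : M.PosSemidef := by
  refine .of_dotProduct_mulVec_nonneg (Matrix.isHermitian_iff_isSymm.2 hM) fun x => ?_
  have hx : star x ⬝ᵥ M *ᵥ x =
      ((Matrix.replicateCol Unit x)ᵀ * (M * Matrix.replicateCol Unit x)).trace := by
    rw [trace_transpose_mul]
    simp [dotProduct, Matrix.mul_apply, Matrix.mulVec]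
  exact hx ▸ h _

variable [DecidableEq k] {M : Matrix k k ℝ}

lemma trace_transpose_add_smul_one_mul (M : Matrix k k ℝ) (c : ℝ) (X : Matrix k l ℝ) :
    (Xᵀ * ((M + c • 1) * X)).trace = (Xᵀ * (M * X)).trace + c * frobNorm X ^ 2 := by
  rw [Matrix.add_mul, Matrix.mul_add, Matrix.trace_add, Matrix.smul_mul, Matrix.one_mul,
    Matrix.mul_smul, Matrix.trace_smul, trace_transpose_mul_self, smul_eq_mul]

lemma posSemidef_add_smul_one_of_abs_trace_le (hM : M.IsSymm) {c : ℝ}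
    (h : ∀ X : Matrix k Unit ℝ, |(Xᵀ * (M * X)).trace| ≤ c * frobNorm X ^ 2) :
    (M + c • 1).PosSemidef := by
  refine posSemidef_of_trace_nonneg (hM.add (Matrix.isSymm_one.smul c)) fun X => ?_
  rw [trace_transpose_add_smul_one_mul]
  linarith [neg_le_of_abs_le (h X)]

lemma posSemidef_add_opNorm_smul_one (hM : M.IsSymm) : (M + opNorm M • 1).PosSemidef :=
  posSemidef_add_smul_one_of_abs_trace_le hM fun X => by
    simpa only [sq, mul_assoc] using abs_trace_transpose_mul_mul_le M X X

lemma posSemidef_sub_smul_one_of_frobNorm_sub_le (hM : M.IsSymm) {c t : ℝ}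
    (h : frobNorm (M - c • 1) ≤ c - t) : (M - t • 1).PosSemidef := by
  have hbound : ∀ X : Matrix k Unit ℝ,
      |(Xᵀ * ((M - c • 1) * X)).trace| ≤ (c - t) * frobNorm X ^ 2 := fun X =>
    calc |(Xᵀ * ((M - c • 1) * X)).trace|
        ≤ frobNorm X * frobNorm ((M - c • 1) * X) := abs_trace_transpose_mul_le _ _
      _ ≤ frobNorm X * (frobNorm (M - c • 1) * frobNorm X) :=
        mul_le_mul_of_nonneg_left (frobNorm_mul_le _ _) (frobNorm_nonneg X)
      _ = frobNorm (M - c • 1) * frobNorm X ^ 2 := by ring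
      _ ≤ (c - t) * frobNorm X ^ 2 := mul_le_mul_of_nonneg_right h (sq_nonneg _)
  have hsplit : M - t • 1 = M - c • 1 + (c - t) • 1 := by rw [sub_smul]; abel
  exact hsplit ▸ posSemidef_add_smul_one_of_abs_trace_le
    (hM.sub (Matrix.isSymm_one.smul c)) hbound

end PosSemidef

section GramMatrix

variable {k l n : Type} [Fintype k] [DecidableEq l] {A T V : Matrix k l ℝ} {P : Matrix l l ℝ}
  {c η : ℝ}

lemma transpose_mul_eq_smul_one_sub (hT : Tᵀ * T = c • 1) (hV : Vᵀ * V = c • 1)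
    (hTV : (Tᵀ * V).IsSymm) :
    Tᵀ * V = c • 1 - (1 / 2 : ℝ) • ((V - T)ᵀ * (V - T)) := by
  have hVT : Vᵀ * T = Tᵀ * V := by
    rw [← hTV.eq, Matrix.transpose_mul, Matrix.transpose_transpose]
  simp only [Matrix.transpose_sub, Matrix.sub_mul, Matrix.mul_sub, hT, hV, hVT]
  module

variable [Fintype l] [Fintype n]

lemma frobNorm_mul_of_transpose_mul_self_eq_one (hA : Aᵀ * A = 1) (Y : Matrix l n ℝ) :
    frobNorm (A * Y) = frobNorm Y := by
  rw [← sq_eq_sq₀ (frobNorm_nonneg _) (frobNorm_nonneg _), ← trace_transpose_mul_self,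
    ← trace_transpose_mul_self, Matrix.transpose_mul, Matrix.mul_assoc, ← Matrix.mul_assoc _ A,
    hA, Matrix.one_mul]

lemma frobNorm_transpose_mul_le_of_transpose_mul_self_eq_one (hA : Aᵀ * A = 1)
    (Y : Matrix k n ℝ) : frobNorm (Aᵀ * Y) ≤ frobNorm Y := by
  have h : frobNorm (Aᵀ * Y) ^ 2 ≤ frobNorm (Aᵀ * Y) * frobNorm Y :=
    calc frobNorm (Aᵀ * Y) ^ 2 = ((A * (Aᵀ * Y))ᵀ * Y).trace := by
          rw [← trace_transpose_mul_self, Matrix.transpose_mul A, Matrix.mul_assoc]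
      _ ≤ frobNorm (A * (Aᵀ * Y)) * frobNorm Y := trace_transpose_mul_le _ _
      _ = frobNorm (Aᵀ * Y) * frobNorm Y := by
          rw [frobNorm_mul_of_transpose_mul_self_eq_one hA]
  nlinarith [frobNorm_nonneg (Aᵀ * Y), frobNorm_nonneg Y]

lemma frobNorm_transpose_mul_sub_smul_one_le (hT : Tᵀ * T = c • 1) (hV : Vᵀ * V = c • 1)
    (hTV : (Tᵀ * V).IsSymm) : frobNorm (Tᵀ * V - c • 1) ≤ frobNorm (V - T) ^ 2 / 2 := by
  have hsq : frobNorm ((V - T)ᵀ * (V - T)) ≤ frobNorm (V - T) ^ 2 := by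
    simpa only [frobNorm_transpose, sq] using frobNorm_mul_le (V - T)ᵀ (V - T)
  rw [transpose_mul_eq_smul_one_sub hT hV hTV, sub_sub_cancel_left, ← neg_smul, frobNorm_smul,
    abs_neg, abs_of_pos one_half_pos]
  linarith

lemma sq_frobNorm_transpose_mul_le (hT : Tᵀ * T = c • 1) (hV : Vᵀ * V = c • 1)
    (hTV : (Tᵀ * V).PosSemidef) :
    frobNorm (Tᵀ * V) ^ 2 ≤ frobNorm (Tᵀ * T) ^ 2 - c / 2 * frobNorm (V - T) ^ 2 := by
  have hsymm : (Tᵀ * V).IsSymm := Matrix.isHermitian_iff_isSymm.1 hTV.1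
  have hP := transpose_mul_eq_smul_one_sub hT hV hsymm
  have hgram : ((V - T)ᵀ * (V - T)).PosSemidef := by
    simpa using posSemidef_mul_transpose_self (V - T)ᵀ
  have hnorm : frobNorm (Tᵀ * V) ^ 2 =
      c * (Tᵀ * V).trace - 1 / 2 * ((Tᵀ * V) * ((V - T)ᵀ * (V - T))).trace := by
    rw [← trace_transpose_mul_self, hsymm.eq]
    nth_rw 2 [hP]
    simp only [Matrix.mul_sub _ (c • (1 : Matrix l l ℝ)), Matrix.trace_sub, Matrix.mul_smul,
      Matrix.mul_one, Matrix.trace_smul, smul_eq_mul]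
  have htrace : (Tᵀ * V).trace = (Tᵀ * T).trace - 1 / 2 * frobNorm (V - T) ^ 2 := by
    rw [hP, ← hT, Matrix.trace_sub, Matrix.trace_smul, trace_transpose_mul_self (V - T),
      smul_eq_mul]
  have hT_norm : frobNorm (Tᵀ * T) ^ 2 = c * (Tᵀ * T).trace := by
    rw [← trace_transpose_mul_self, hT]
    simp
  rw [hnorm, htrace, hT_norm]
  linarith [trace_mul_nonneg hTV hgram]

lemma mul_sq_frobNorm_le_trace_transpose_mul_self_mul (hP : P.IsSymm)
    (hη : frobNorm (P - c • 1) ≤ η) (X : Matrix k l ℝ) :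
    (c - η) * frobNorm X ^ 2 ≤ (Xᵀ * X * P).trace := by
  have hpos : (P - (c - η) • 1).PosSemidef :=
    posSemidef_sub_smul_one_of_frobNorm_sub_le hP (by rwa [sub_sub_cancel])
  have hgram : (Xᵀ * X).PosSemidef := by simpa using posSemidef_mul_transpose_self Xᵀ
  have htrace := trace_mul_nonneg hgram hpos
  rw [Matrix.mul_sub, Matrix.trace_sub, Matrix.mul_smul, Matrix.mul_one, Matrix.trace_smul,
    trace_transpose_mul_self, smul_eq_mul] at htrace
  linarith

lemma frobNorm_transpose_mul_add_sub_smul_one_le (hA : Aᵀ * A = 1) (B N : Matrix k l ℝ)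
    (hc : 0 ≤ c) (hη : frobNorm (P - c • 1) ≤ η) :
    frobNorm (Aᵀ * (B * P + N) - c • 1) ≤ η + frobNorm (A - B) * (c + η) + frobNorm N := by
  have hsplit : Aᵀ * (B * P + N) - c • 1 = P - c • 1 - Aᵀ * ((A - B) * P) + Aᵀ * N := by
    rw [Matrix.sub_mul, Matrix.mul_sub, ← Matrix.mul_assoc Aᵀ A, hA, Matrix.one_mul,
      Matrix.mul_add]
    abel
  have hAB : frobNorm ((A - B) * P) ≤ frobNorm (A - B) * (c + η) := by
    have hP : (A - B) * P = c • (A - B) + (A - B) * (P - c • 1) := by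
      rw [Matrix.mul_sub (A - B), Matrix.mul_smul, Matrix.mul_one, add_sub_cancel]
    calc frobNorm ((A - B) * P)
        ≤ frobNorm (c • (A - B)) + frobNorm ((A - B) * (P - c • 1)) := hP ▸ frobNorm_add_le _ _
      _ ≤ c * frobNorm (A - B) + frobNorm (A - B) * η := by
          rw [frobNorm_smul, abs_of_nonneg hc]
          exact add_le_add_right ((frobNorm_mul_le _ _).trans
            (mul_le_mul_of_nonneg_left hη (frobNorm_nonneg _))) _
      _ = frobNorm (A - B) * (c + η) := by ring
  calc frobNorm (Aᵀ * (B * P + N) - c • 1)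
      ≤ frobNorm (P - c • 1) + frobNorm (Aᵀ * ((A - B) * P)) + frobNorm (Aᵀ * N) := by
        rw [hsplit]
        exact (frobNorm_add_le _ _).trans (add_le_add_left (frobNorm_sub_le _ _) _)
    _ ≤ η + frobNorm (A - B) * (c + η) + frobNorm N :=
        add_le_add (add_le_add hη
          ((frobNorm_transpose_mul_le_of_transpose_mul_self_eq_one hA _).trans hAB))
          (frobNorm_transpose_mul_le_of_transpose_mul_self_eq_one hA N)

end GramMatrix

section Stiefel

variable {n r : ℕ} {O B : Matrix (Fin n) (Fin r) ℝ}

lemma sq_frobNorm_of_mem_stiefel (hO : O ∈ stiefel n r) : frobNorm O ^ 2 = r := by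
  rw [← trace_transpose_mul_self, show Oᵀ * O = 1 from hO, Matrix.trace_one, Fintype.card_fin]

lemma orthogonal_mul_mem_stiefel {G : Matrix (Fin n) (Fin n) ℝ} (hG : Gᵀ * G = 1)
    (hO : O ∈ stiefel n r) : G * O ∈ stiefel n r := by
  change (G * O)ᵀ * (G * O) = 1
  rw [Matrix.transpose_mul, Matrix.mul_assoc, ← Matrix.mul_assoc _ G, hG, Matrix.one_mul, hO]

lemma mul_orthogonal_mem_stiefel (hO : O ∈ stiefel n r) {Q : Matrix (Fin r) (Fin r) ℝ}
    (hQ : Qᵀ * Q = 1) : O * Q ∈ stiefel n r := by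
  change (O * Q)ᵀ * (O * Q) = 1
  rw [Matrix.transpose_mul, Matrix.mul_assoc, ← Matrix.mul_assoc _ O, show Oᵀ * O = 1 from hO,
    Matrix.one_mul, hQ]

lemma posSemidef_one_sub_mul_transpose (hO : O ∈ stiefel n r) : (1 - O * Oᵀ).PosSemidef := by
  have hproj : O * Oᵀ * (O * Oᵀ) = O * Oᵀ := by
    rw [Matrix.mul_assoc, ← Matrix.mul_assoc _ O, hO, Matrix.one_mul]
  have hsq : (1 - O * Oᵀ) * (1 - O * Oᵀ)ᵀ = 1 - O * Oᵀ := by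
    simp [Matrix.sub_mul, Matrix.mul_sub, hproj]
  exact hsq ▸ posSemidef_mul_transpose_self _

lemma trace_transpose_mul_self_mul_of_mem_stiefel {A : Matrix (Fin n) (Fin r) ℝ}
    (hA : A ∈ stiefel n r) (hB : B ∈ stiefel n r) {P : Matrix (Fin r) (Fin r) ℝ}
    (hP : P.IsSymm) :
    ((A - B)ᵀ * (A - B) * P).trace = 2 * ((A - B)ᵀ * (A * P)).trace := by
  have hgram : (A - B)ᵀ * (A - B) = (A - B)ᵀ * A + Aᵀ * (A - B) := by
    simp only [Matrix.transpose_sub, Matrix.sub_mul, Matrix.mul_sub, show Aᵀ * A = 1 from hA,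
      show Bᵀ * B = 1 from hB]
    abel
  have hswap : (Aᵀ * (A - B) * P).trace = ((A - B)ᵀ * (A * P)).trace := by
    rw [trace_transpose_mul_comm (A - B), Matrix.transpose_mul, hP.eq, Matrix.trace_mul_comm,
      Matrix.mul_assoc]
  rw [hgram, Matrix.add_mul, Matrix.trace_add, hswap, Matrix.mul_assoc]
  ring

lemma isCompact_stiefel : IsCompact (stiefel n r) := by
  refine (isCompact_univ_pi fun _ : Fin n => isCompact_univ_pi fun _ : Fin r =>
    isCompact_Icc (a := (-√r : ℝ)) (b := √r)).of_isClosed_subset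
    (isClosed_eq (by fun_prop) continuous_const) ?_
  intro (O : Matrix (Fin n) (Fin r) ℝ) hO i _ j _
  refine abs_le.1 (Real.abs_le_sqrt ?_)
  rw [← sq_frobNorm_of_mem_stiefel hO, sq_frobNorm]
  calc O i j ^ 2 ≤ ∑ j, O i j ^ 2 :=
        Finset.single_le_sum (f := fun j => O i j ^ 2) (fun _ _ => sq_nonneg _)
          (Finset.mem_univ j)
    _ ≤ ∑ i, ∑ j, O i j ^ 2 :=
        Finset.single_le_sum (f := fun i => ∑ j, O i j ^ 2) (fun _ _ => by positivity)
          (Finset.mem_univ i)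

lemma transpose_exp_mul_exp_of_skew {J : Matrix (Fin n) (Fin n) ℝ} (hJ : Jᵀ = -J) :
    (NormedSpace.exp J)ᵀ * NormedSpace.exp J = 1 := by
  rw [← Matrix.exp_transpose, hJ, ← Matrix.exp_add_of_commute _ _ (Commute.refl J).neg_left,
    neg_add_cancel, NormedSpace.exp_zero]

open scoped Matrix.Norms.Frobenius in
lemma trace_skew_mul_eq_zero_of_isMax (hO : O ∈ stiefel n r)
    (hmax : ∀ O' ∈ stiefel n r, (O'ᵀ * B).trace ≤ (Oᵀ * B).trace)
    {J : Matrix (Fin n) (Fin n) ℝ} (hJ : Jᵀ = -J) : (J * (O * Bᵀ)).trace = 0 := by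
  let φ : Matrix (Fin n) (Fin n) ℝ →L[ℝ] ℝ := LinearMap.toContinuousLinearMap
    (Matrix.traceLinearMap (Fin n) ℝ ℝ ∘ₗ LinearMap.mulRight ℝ (O * Bᵀ))
  have hφ : ∀ G, φ G = ((G * O)ᵀ * B).trace := fun G => by
    rw [trace_transpose_mul_comm, Matrix.trace_mul_comm, Matrix.mul_assoc]
    rfl
  have hderiv : HasDerivAt (fun t : ℝ => φ (NormedSpace.exp (t • J))) (φ J) 0 := by
    have hexp := hasDerivAt_exp_smul_const J (0 : ℝ)
    rw [zero_smul, NormedSpace.exp_zero, one_mul] at hexp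
    exact φ.hasFDerivAt.comp_hasDerivAt (0 : ℝ) hexp
  refine IsLocalMax.hasDerivAt_eq_zero (.of_forall fun t => ?_) hderiv
  have hskew : (t • J)ᵀ = -(t • J) := by rw [Matrix.transpose_smul, hJ, smul_neg]
  simpa [hφ] using
    hmax _ (orthogonal_mul_mem_stiefel (transpose_exp_mul_exp_of_skew hskew) hO)

lemma isSymm_mul_transpose_of_isMax (hO : O ∈ stiefel n r)
    (hmax : ∀ O' ∈ stiefel n r, (O'ᵀ * B).trace ≤ (Oᵀ * B).trace) : (O * Bᵀ).IsSymm := by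
  set C := O * Bᵀ
  have hskew : (Cᵀ - C)ᵀ = -(Cᵀ - C) := by simp
  have htrace : ((Cᵀ - C) * C).trace = 0 := trace_skew_mul_eq_zero_of_isMax hO hmax hskew
  have hnorm : frobNorm (Cᵀ - C) ^ 2 = 2 * ((Cᵀ - C) * C).trace := by
    rw [← trace_transpose_mul_self, hskew, neg_mul, Matrix.mul_sub, Matrix.trace_neg,
      Matrix.trace_sub]
    have hswap : ((Cᵀ - C) * Cᵀ).trace = -((Cᵀ - C) * C).trace := by
      rw [← Matrix.trace_transpose, Matrix.transpose_mul, hskew, Matrix.transpose_transpose,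
        mul_neg, Matrix.trace_neg, Matrix.trace_mul_comm]
    rw [hswap]
    ring
  rw [htrace, mul_zero, sq_eq_zero_iff, frobNorm_eq_zero] at hnorm
  exact sub_eq_zero.1 hnorm

lemma isSymm_and_eq_mul_of_isMax (hO : O ∈ stiefel n r)
    (hmax : ∀ O' ∈ stiefel n r, (O'ᵀ * B).trace ≤ (Oᵀ * B).trace) :
    (Oᵀ * B).IsSymm ∧ B = O * (Oᵀ * B) := by
  have hOO : Oᵀ * O = 1 := hO
  have hBO : B * Oᵀ = O * Bᵀ := by
    simpa using (isSymm_mul_transpose_of_isMax hO hmax).eq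
  have hB : B = O * (Bᵀ * O) := by
    rw [← Matrix.mul_assoc, ← hBO, Matrix.mul_assoc, hOO, Matrix.mul_one]
  have hsymm : Oᵀ * B = Bᵀ * O := by
    conv_lhs => rw [hB]
    rw [← Matrix.mul_assoc, hOO, Matrix.one_mul]
  exact ⟨by rw [Matrix.IsSymm, Matrix.transpose_mul, Matrix.transpose_transpose, hsymm],
    hsymm ▸ hB⟩

/-- The reflection `1 - 2 x xᵀ / |x|²` in the hyperplane orthogonal to `x`, which is the identity
for `x = 0`. -/
noncomputable def householder (x : Fin r → ℝ) : Matrix (Fin r) (Fin r) ℝ :=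
  1 - (2 / (x ⬝ᵥ x)) • Matrix.vecMulVec x x

lemma transpose_householder (x : Fin r → ℝ) : (householder x)ᵀ = householder x := by
  simp [householder, Matrix.transpose_vecMulVec]

lemma transpose_householder_mul_self (x : Fin r → ℝ) :
    (householder x)ᵀ * householder x = 1 := by
  rw [transpose_householder, householder]
  rcases eq_or_ne (x ⬝ᵥ x) 0 with hx | hx
  · simp [hx]
  have hsq : Matrix.vecMulVec x x * Matrix.vecMulVec x x = (x ⬝ᵥ x) • Matrix.vecMulVec x x := by
    rw [Matrix.vecMulVec_mul_vecMulVec, Matrix.vecMulVec_smul]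
  simp only [Matrix.sub_mul, Matrix.mul_sub, Matrix.one_mul, Matrix.mul_one, Matrix.smul_mul,
    Matrix.mul_smul, hsq, smul_smul]
  match_scalars <;> field_simp
  ring

lemma trace_householder_mul (x : Fin r → ℝ) (M : Matrix (Fin r) (Fin r) ℝ) :
    (householder x * M).trace = M.trace - 2 / (x ⬝ᵥ x) * (x ⬝ᵥ M *ᵥ x) := by
  rw [householder, Matrix.sub_mul, Matrix.one_mul, Matrix.trace_sub, Matrix.smul_mul,
    Matrix.trace_smul, Matrix.vecMulVec_mul, Matrix.trace_vecMulVec,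
    dotProduct_comm x (x ᵥ* M), ← Matrix.dotProduct_mulVec, smul_eq_mul]

lemma posSemidef_of_isMax (hO : O ∈ stiefel n r)
    (hmax : ∀ O' ∈ stiefel n r, (O'ᵀ * B).trace ≤ (Oᵀ * B).trace) : (Oᵀ * B).PosSemidef := by
  refine .of_dotProduct_mulVec_nonneg
    (Matrix.isHermitian_iff_isSymm.2 (isSymm_and_eq_mul_of_isMax hO hmax).1) fun x => ?_
  rw [star_trivial]
  rcases eq_or_ne x 0 with rfl | hx
  · simp
  have hxx : 0 < x ⬝ᵥ x := by simpa using Matrix.dotProduct_star_self_pos_iff.2 hx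
  have hreflect := hmax _ (mul_orthogonal_mem_stiefel hO (transpose_householder_mul_self x))
  rw [Matrix.transpose_mul, transpose_householder, Matrix.mul_assoc, trace_householder_mul]
    at hreflect
  exact nonneg_of_mul_nonneg_right (by linarith) (div_pos two_pos hxx)

lemma exists_orthogonal_posSemidef (M : Matrix (Fin r) (Fin r) ℝ) :
    ∃ Q : Matrix (Fin r) (Fin r) ℝ, Qᵀ * Q = 1 ∧ (Qᵀ * M).PosSemidef := by
  obtain ⟨Q, hQ, hmax⟩ := (isCompact_stiefel (n := r) (r := r)).exists_isMaxOn
    ⟨1, by simp [stiefel]⟩ (f := fun Q => (Qᵀ * M).trace) (by fun_prop)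
  exact ⟨Q, hQ, posSemidef_of_isMax hQ fun Q' hQ' => hmax hQ'⟩

end Stiefel

section Blocks

variable {m r : ℕ} {d : Fin m → ℕ}

lemma dataMatrix_eq (Θ : (i : Fin m) → Matrix (Fin (d i)) (Fin r) ℝ)
    (W : Matrix (Idx d) (Idx d) ℝ) : dataMatrix Θ W = stack Θ * (stack Θ)ᵀ + W := by
  ext p q
  simp [dataMatrix, stack, block, Matrix.mul_apply]

lemma trace_stack_transpose_mul (O : (i : Fin m) → Matrix (Fin (d i)) (Fin r) ℝ)
    (Y : Matrix (Idx d) (Fin r) ℝ) :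
    ((stack O)ᵀ * Y).trace = ∑ i, ((O i)ᵀ * rowBlock Y i).trace := by
  simp only [trace_transpose_mul, stack, rowBlock, Matrix.of_apply, Fintype.sum_sigma]

lemma sq_frobNorm_eq_sum_rowBlock (Y : Matrix (Idx d) (Fin r) ℝ) :
    frobNorm Y ^ 2 = ∑ i, frobNorm (rowBlock Y i) ^ 2 := by
  simp only [sq_frobNorm, rowBlock, Matrix.of_apply, Fintype.sum_sigma]

lemma frobNorm_rowBlock_le (Y : Matrix (Idx d) (Fin r) ℝ) (i : Fin m) :
    frobNorm (rowBlock Y i) ≤ frobNorm Y := by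
  refine (abs_le_of_sq_le_sq' ?_ (frobNorm_nonneg Y)).2
  rw [sq_frobNorm_eq_sum_rowBlock]
  exact Finset.single_le_sum (f := fun i => frobNorm (rowBlock Y i) ^ 2)
    (fun _ _ => sq_nonneg _) (Finset.mem_univ i)

lemma rowBlock_ext {X Y : Matrix (Idx d) (Fin r) ℝ}
    (h : ∀ i, rowBlock X i = rowBlock Y i) : X = Y := by
  ext ⟨i, a⟩ k
  exact congrFun (congrFun (h i) a) k

lemma stack_transpose_mul_stack (O O' : (i : Fin m) → Matrix (Fin (d i)) (Fin r) ℝ) :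
    (stack O)ᵀ * stack O' = ∑ i, (O i)ᵀ * O' i := by
  ext a b
  simp [Matrix.mul_apply, stack, Fintype.sum_sigma, Matrix.sum_apply]

lemma traceSum_eq_trace (S : Matrix (Idx d) (Idx d) ℝ)
    (O : (i : Fin m) → Matrix (Fin (d i)) (Fin r) ℝ) :
    traceSum S O = ((stack O)ᵀ * (S * stack O)).trace := by
  have hrow : ∀ i, rowBlock (S * stack O) i = ∑ j, block S i j * O j := fun i => by
    ext a k
    simp [rowBlock, block, stack, Matrix.mul_apply, Matrix.sum_apply, Fintype.sum_sigma]
  simp only [traceSum, trace_stack_transpose_mul, hrow, Matrix.mul_sum, Matrix.trace_sum,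
    Matrix.mul_assoc]

lemma trace_blockDiagonal'_mul (K : (i : Fin m) → Matrix (Fin (d i)) (Fin (d i)) ℝ)
    (U : Matrix (Idx d) (Idx d) ℝ) :
    (Matrix.blockDiagonal' K * U).trace = ∑ i, (K i * block U i i).trace := by
  simp only [Matrix.trace, Matrix.diag_apply, Matrix.mul_apply, Fintype.sum_sigma, block,
    Matrix.of_apply]
  refine Finset.sum_congr rfl fun i _ => Finset.sum_congr rfl fun a _ => ?_
  rw [Finset.sum_eq_single i (fun j _ hj => Finset.sum_eq_zero fun b _ => by
    rw [Matrix.blockDiagonal'_apply_ne _ _ _ hj.symm, zero_mul]) (by simp)]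
  simp only [Matrix.blockDiagonal'_apply_eq]

lemma rowBlock_blockDiagonal'_mul (K : (i : Fin m) → Matrix (Fin (d i)) (Fin (d i)) ℝ)
    (Y : Matrix (Idx d) (Fin r) ℝ) (i : Fin m) :
    rowBlock (Matrix.blockDiagonal' K * Y) i = K i * rowBlock Y i := by
  ext a k
  simp only [rowBlock, Matrix.of_apply, Matrix.mul_apply, Fintype.sum_sigma]
  rw [Finset.sum_eq_single i (fun j _ hj => Finset.sum_eq_zero fun b _ => by
    rw [Matrix.blockDiagonal'_apply_ne _ _ _ hj.symm, zero_mul]) (by simp)]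
  simp only [Matrix.blockDiagonal'_apply_eq]

lemma trace_eq_sum_block (U : Matrix (Idx d) (Idx d) ℝ) :
    U.trace = ∑ i, (block U i i).trace := by
  simp [Matrix.trace, block, Fintype.sum_sigma]

lemma posSemidef_block {U : Matrix (Idx d) (Idx d) ℝ} (hU : U.PosSemidef) (i : Fin m) :
    (block U i i).PosSemidef := hU.submatrix (Sigma.mk i)

end Blocks

section StackedStiefel

variable {m r : ℕ} {d : Fin m → ℕ} {O : (i : Fin m) → Matrix (Fin (d i)) (Fin r) ℝ}

lemma stack_transpose_mul_self (hO : ∀ i, O i ∈ stiefel (d i) r) :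
    (stack O)ᵀ * stack O = (m : ℝ) • 1 := by
  rw [stack_transpose_mul_stack, Finset.sum_congr rfl fun i _ => hO i]
  simp [Nat.cast_smul_eq_nsmul]

lemma sq_frobNorm_stack (hO : ∀ i, O i ∈ stiefel (d i) r) :
    frobNorm (stack O) ^ 2 = m * r := by
  rw [← trace_transpose_mul_self, stack_transpose_mul_self hO]
  simp

lemma stack_mul_transpose_mem_sdpFeasible (hO : ∀ i, O i ∈ stiefel (d i) r) :
    stack O * (stack O)ᵀ ∈ sdpFeasible d r := by
  refine ⟨by simp [Matrix.IsSymm], posSemidef_mul_transpose_self _, fun i =>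
    ⟨posSemidef_one_sub_mul_transpose (hO i), ?_⟩⟩
  change (O i * (O i)ᵀ).trace = r
  rw [Matrix.trace_mul_comm, trace_transpose_mul_self, sq_frobNorm_of_mem_stiefel (hO i)]

lemma rank_stack_mul_transpose (hm : 0 < m) (hO : ∀ i, O i ∈ stiefel (d i) r) :
    (stack O * (stack O)ᵀ).rank = r := by
  have hm0 : (m : ℝ) ≠ 0 := Nat.cast_ne_zero.2 hm.ne'
  rw [Matrix.rank_self_mul_transpose, ← Matrix.rank_transpose_mul_self,
    stack_transpose_mul_self hO, Matrix.rank_of_isUnit, Fintype.card_fin]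
  exact (Matrix.isUnit_iff_isUnit_det _).2 (by simp [hm0])

lemma eq_one_of_stack_mul_mul_transpose_mem_sdpFeasible (hm : 0 < m)
    (hO : ∀ i, O i ∈ stiefel (d i) r) {C : Matrix (Fin r) (Fin r) ℝ}
    (hC : stack O * C * (stack O)ᵀ ∈ sdpFeasible d r) : C = 1 := by
  set A := O ⟨0, hm⟩
  have hAA : Aᵀ * A = 1 := hO ⟨0, hm⟩
  obtain ⟨hle, htrace⟩ : (1 - A * C * Aᵀ).PosSemidef ∧ (A * C * Aᵀ).trace = r :=
    hC.2.2 ⟨0, hm⟩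
  have hpos : (1 - C).PosSemidef := by
    have h := hle.conjTranspose_mul_mul_same A
    rwa [Matrix.conjTranspose_eq_transpose_of_trivial, Matrix.mul_sub, Matrix.sub_mul,
      Matrix.mul_one, hAA, Matrix.mul_assoc A, ← Matrix.mul_assoc Aᵀ, hAA, Matrix.one_mul,
      Matrix.mul_assoc, hAA, Matrix.mul_one] at h
  have hzero : (1 - C).trace = 0 := by
    rw [Matrix.trace_mul_comm, ← Matrix.mul_assoc, hAA, Matrix.one_mul] at htrace
    rw [Matrix.trace_sub, htrace, Matrix.trace_one, Fintype.card_fin, sub_self]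
  exact (sub_eq_zero.1 (hpos.trace_eq_zero_iff.1 hzero)).symm

lemma exists_eq_stack_mul_add (hm : 0 < m) (hO : ∀ i, O i ∈ stiefel (d i) r) {l : Type}
    (X : Matrix (Idx d) l ℝ) :
    ∃ (Y : Matrix (Fin r) l ℝ) (Z : Matrix (Idx d) l ℝ),
      X = stack O * Y + Z ∧ (stack O)ᵀ * Z = 0 := by
  have hm0 : (m : ℝ) ≠ 0 := Nat.cast_ne_zero.2 hm.ne'
  refine ⟨(m : ℝ)⁻¹ • ((stack O)ᵀ * X), X - stack O * ((m : ℝ)⁻¹ • ((stack O)ᵀ * X)),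
    (add_sub_cancel _ _).symm, ?_⟩
  rw [Matrix.mul_sub, ← Matrix.mul_assoc, stack_transpose_mul_self hO, Matrix.smul_mul,
    Matrix.one_mul, smul_inv_smul₀ hm0, sub_self]

end StackedStiefel

section DualCertificate

variable {m r : ℕ} {d : Fin m → ℕ} {O : (i : Fin m) → Matrix (Fin (d i)) (Fin r) ℝ}
  {M : Fin m → Matrix (Fin r) (Fin r) ℝ} {t : ℝ} {S : Matrix (Idx d) (Idx d) ℝ}

/-- The dual variable for the block constraints `U_{ii} ≼ I` and `tr U_{ii} = r` of the
semidefinite relaxation: `O_i M_i O_iᵀ`, with `M_i ≽ 0`, prices the first one, and `t I` the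
second one. -/
def dualCertificate (O : (i : Fin m) → Matrix (Fin (d i)) (Fin r) ℝ)
    (M : Fin m → Matrix (Fin r) (Fin r) ℝ) (t : ℝ) : Matrix (Idx d) (Idx d) ℝ :=
  Matrix.blockDiagonal' fun i => O i * M i * (O i)ᵀ + t • 1

lemma isSymm_dualCertificate (hM : ∀ i, (M i).PosSemidef) : (dualCertificate O M t).IsSymm := by
  have hMt : ∀ i, (M i)ᵀ = M i := fun i => (Matrix.isHermitian_iff_isSymm.1 (hM i).1).eq
  simp only [Matrix.IsSymm, dualCertificate, Matrix.blockDiagonal'_transpose,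
    Matrix.transpose_add, Matrix.transpose_mul, Matrix.transpose_transpose, hMt,
    Matrix.transpose_smul, Matrix.transpose_one, Matrix.mul_assoc]

lemma trace_dualCertificate_mul (U : Matrix (Idx d) (Idx d) ℝ) :
    (dualCertificate O M t * U).trace =
      ∑ i, ((M i * ((O i)ᵀ * block U i i * O i)).trace + t * (block U i i).trace) := by
  rw [dualCertificate, trace_blockDiagonal'_mul]
  refine Finset.sum_congr rfl fun i _ => ?_
  rw [Matrix.add_mul, Matrix.trace_add, Matrix.smul_mul, Matrix.one_mul, Matrix.trace_smul,
    smul_eq_mul, Matrix.mul_assoc (O i), Matrix.mul_assoc (O i), Matrix.trace_mul_comm (O i)]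
  simp only [Matrix.mul_assoc]

lemma dualCertificate_mul_stack (hO : ∀ i, O i ∈ stiefel (d i) r)
    (hSO : ∀ i, rowBlock (S * stack O) i = O i * (M i + t • 1)) :
    dualCertificate O M t * stack O = S * stack O := by
  refine rowBlock_ext fun i => ?_
  rw [dualCertificate, rowBlock_blockDiagonal'_mul, hSO]
  change (O i * M i * (O i)ᵀ + t • 1) * O i = _
  rw [Matrix.add_mul, Matrix.mul_assoc, show (O i)ᵀ * O i = 1 from hO i, Matrix.mul_one,
    Matrix.smul_mul, Matrix.one_mul, Matrix.mul_add, Matrix.mul_smul, Matrix.mul_one]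

lemma trace_dualCertificate_mul_le (hO : ∀ i, O i ∈ stiefel (d i) r)
    (hM : ∀ i, (M i).PosSemidef) {U : Matrix (Idx d) (Idx d) ℝ} (hU : U ∈ sdpFeasible d r) :
    (dualCertificate O M t * U).trace ≤
      (dualCertificate O M t * (stack O * (stack O)ᵀ)).trace := by
  rw [trace_dualCertificate_mul, trace_dualCertificate_mul]
  refine Finset.sum_le_sum fun i _ => ?_
  have hOO : (O i)ᵀ * O i = 1 := hO i
  rw [(hU.2.2 i).2, ((stack_mul_transpose_mem_sdpFeasible hO).2.2 i).2,
    show block (stack O * (stack O)ᵀ) i i = O i * (O i)ᵀ from rfl,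
    ← Matrix.mul_assoc (O i)ᵀ, hOO, Matrix.one_mul, hOO]
  have hgap := trace_mul_nonneg (hM i) ((hU.2.2 i).1.conjTranspose_mul_mul_same (O i))
  rw [Matrix.conjTranspose_eq_transpose_of_trivial, Matrix.mul_sub, Matrix.mul_one,
    Matrix.sub_mul, hOO, Matrix.mul_sub, Matrix.trace_sub] at hgap
  linarith

lemma mul_sq_frobNorm_le_trace_dualCertificate (hM : ∀ i, (M i).PosSemidef) {l : Type}
    [Fintype l] (Z : Matrix (Idx d) l ℝ) :
    t * frobNorm Z ^ 2 ≤ (Zᵀ * (dualCertificate O M t * Z)).trace := by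
  rw [← trace_mul_mul_transpose, trace_dualCertificate_mul, ← trace_transpose_mul_self,
    Matrix.trace_mul_comm, trace_eq_sum_block, Finset.mul_sum]
  refine Finset.sum_le_sum fun i _ => le_add_of_nonneg_left (trace_mul_nonneg (hM i) ?_)
  exact (posSemidef_block (posSemidef_mul_transpose_self Z) i).conjTranspose_mul_mul_same (O i)

lemma trace_mul_add_gap_le (hS : S.IsSymm) (hO : ∀ i, O i ∈ stiefel (d i) r)
    (hM : ∀ i, (M i).PosSemidef)
    (hSO : ∀ i, rowBlock (S * stack O) i = O i * (M i + t • 1)) {l : Type} [Fintype l]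
    {Y : Matrix (Fin r) l ℝ} {Z : Matrix (Idx d) l ℝ}
    (hU : (stack O * Y + Z) * (stack O * Y + Z)ᵀ ∈ sdpFeasible d r) :
    (S * ((stack O * Y + Z) * (stack O * Y + Z)ᵀ)).trace +
        (t * frobNorm Z ^ 2 - (Zᵀ * (S * Z)).trace) ≤ (S * (stack O * (stack O)ᵀ)).trace := by
  set L := dualCertificate O M t
  have hLO : L * stack O = S * stack O := dualCertificate_mul_stack hO hSO
  have hslack := trace_transpose_mul_mul_add_of_mul_eq_zero
    ((isSymm_dualCertificate hM).sub hS) (V := stack O)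
    (by rw [Matrix.sub_mul, hLO, sub_self]) Y Z
  have hopt : (L * ((stack O * Y + Z) * (stack O * Y + Z)ᵀ)).trace ≤
      (S * (stack O * (stack O)ᵀ)).trace := by
    rw [← Matrix.mul_assoc S, ← hLO, Matrix.mul_assoc]
    exact trace_dualCertificate_mul_le hO hM hU
  rw [trace_mul_mul_transpose] at hopt ⊢
  simp only [Matrix.sub_mul, Matrix.mul_sub, Matrix.trace_sub] at hslack
  linarith [mul_sq_frobNorm_le_trace_dualCertificate (O := O) (t := t) hM Z]

theorem isSDPSolution_iff_eq_stack_of_dualCertificate (hm : 0 < m) (hS : S.IsSymm)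
    (hO : ∀ i, O i ∈ stiefel (d i) r) (hM : ∀ i, (M i).PosSemidef)
    (hSO : ∀ i, rowBlock (S * stack O) i = O i * (M i + t • 1))
    (hlt : ∀ Z : Matrix (Idx d) (Idx d) ℝ, (stack O)ᵀ * Z = 0 → Z ≠ 0 →
      (Zᵀ * (S * Z)).trace < t * frobNorm Z ^ 2) (U : Matrix (Idx d) (Idx d) ℝ) :
    IsSDPSolution r S U ↔ U = stack O * (stack O)ᵀ := by
  have hmem := stack_mul_transpose_mem_sdpFeasible hO
  rw [IsSDPSolution, hS.eq]
  constructor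
  · rintro ⟨hU, hmax⟩
    obtain ⟨X, rfl⟩ := exists_eq_mul_transpose hU.2.1
    obtain ⟨Y, Z, rfl, hZ⟩ := exists_eq_stack_mul_add hm hO X
    have hZ0 : Z = 0 := by
      by_contra hne
      linarith [hlt Z hZ hne, hmax _ hmem, trace_mul_add_gap_le hS hO hM hSO hU]
    have hfactor : (stack O * Y + Z) * (stack O * Y + Z)ᵀ =
        stack O * (Y * Yᵀ) * (stack O)ᵀ := by
      simp only [hZ0, add_zero, Matrix.transpose_mul, Matrix.mul_assoc]
    rw [hfactor] at hU ⊢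
    rw [eq_one_of_stack_mul_mul_transpose_mem_sdpFeasible hm hO hU, Matrix.mul_one]
  · rintro rfl
    refine ⟨hmem, fun U hU => ?_⟩
    obtain ⟨X, rfl⟩ := exists_eq_mul_transpose hU.2.1
    obtain ⟨Y, Z, rfl, hZ⟩ := exists_eq_stack_mul_add hm hO X
    have hgap := trace_mul_add_gap_le hS hO hM hSO hU
    rcases eq_or_ne Z 0 with rfl | hne
    · simpa [frobNorm_eq_zero.2 rfl] using hgap
    · linarith [hlt Z hZ hne]

end DualCertificate

section TraceSumSolution

variable {m r : ℕ} {d : Fin m → ℕ} {O : (i : Fin m) → Matrix (Fin (d i)) (Fin r) ℝ}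
  {S : Matrix (Idx d) (Idx d) ℝ}

lemma stack_update (O : (i : Fin m) → Matrix (Fin (d i)) (Fin r) ℝ) (i : Fin m)
    (A : Matrix (Fin (d i)) (Fin r) ℝ) :
    stack (Function.update O i A) = stack O +
      stack (Pi.single (M := fun i => Matrix (Fin (d i)) (Fin r) ℝ) i (A - O i)) := by
  refine rowBlock_ext fun j => ?_
  change Function.update O i A j =
    O j + Pi.single (M := fun i => Matrix (Fin (d i)) (Fin r) ℝ) i (A - O i) j
  rcases eq_or_ne j i with rfl | hj
  · simp
  · simp [hj]

lemma trace_stack_single_transpose_mul (i : Fin m) (A : Matrix (Fin (d i)) (Fin r) ℝ)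
    (Y : Matrix (Idx d) (Fin r) ℝ) :
    ((stack (Pi.single (M := fun i => Matrix (Fin (d i)) (Fin r) ℝ) i A))ᵀ * Y).trace =
      (Aᵀ * rowBlock Y i).trace := by
  rw [trace_stack_transpose_mul, Finset.sum_eq_single i (fun j _ hj => by
    rw [Pi.single_eq_of_ne hj, Matrix.transpose_zero, Matrix.zero_mul, Matrix.trace_zero])
    (by simp), Pi.single_eq_same]

lemma frobNorm_stack_single (i : Fin m) (A : Matrix (Fin (d i)) (Fin r) ℝ) :
    frobNorm (stack (Pi.single (M := fun i => Matrix (Fin (d i)) (Fin r) ℝ) i A)) =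
      frobNorm A := by
  rw [← sq_eq_sq₀ (frobNorm_nonneg _) (frobNorm_nonneg _), ← trace_transpose_mul_self,
    trace_stack_single_transpose_mul, ← trace_transpose_mul_self]
  change (Aᵀ * (Pi.single i A : ∀ j, Matrix (Fin (d j)) (Fin r) ℝ) i).trace = _
  rw [Pi.single_eq_same]

lemma IsTraceSumSolution.two_mul_trace_sub_le (hO : IsTraceSumSolution S O) (hS : S.IsSymm)
    {c : ℝ} (hc : (S + c • 1).PosSemidef) (i : Fin m) {A : Matrix (Fin (d i)) (Fin r) ℝ}
    (hA : A ∈ stiefel (d i) r) :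
    2 * ((A - O i)ᵀ * rowBlock (S * stack O) i).trace ≤ c * frobNorm (A - O i) ^ 2 := by
  have hle := hO.2 (Function.update O i A) fun j => by
    rcases eq_or_ne j i with rfl | hj
    · simpa using hA
    · simpa [hj] using hO.1 j
  rw [traceSum_eq_trace, traceSum_eq_trace, stack_update, trace_transpose_mul_mul_add hS,
    trace_stack_single_transpose_mul] at hle
  have hcurv := trace_transpose_mul_mul_nonneg hc
    (stack (Pi.single (M := fun i => Matrix (Fin (d i)) (Fin r) ℝ) i (A - O i)))
  rw [trace_transpose_add_smul_one_mul, frobNorm_stack_single] at hcurv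
  linarith

/-- On the Stiefel manifold the quadratic bound of `two_mul_trace_sub_le` is itself linear, so each
block of a solution maximizes the linear form given by `[S O]_i + c O_i`. -/
lemma IsTraceSumSolution.trace_transpose_mul_add_smul_le (hO : IsTraceSumSolution S O)
    (hS : S.IsSymm) {c : ℝ} (hc : (S + c • 1).PosSemidef) (i : Fin m)
    {A : Matrix (Fin (d i)) (Fin r) ℝ} (hA : A ∈ stiefel (d i) r) :
    (Aᵀ * (rowBlock (S * stack O) i + c • O i)).trace ≤
      ((O i)ᵀ * (rowBlock (S * stack O) i + c • O i)).trace := by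
  have hle := hO.two_mul_trace_sub_le hS hc i hA
  rw [← trace_transpose_mul_self] at hle
  simp only [Matrix.transpose_sub, Matrix.sub_mul, Matrix.mul_sub, Matrix.trace_sub,
    show Aᵀ * A = 1 from hA, show (O i)ᵀ * O i = 1 from hO.1 i,
    trace_transpose_mul_comm (O i) A] at hle
  simp only [Matrix.mul_add, Matrix.trace_add, Matrix.mul_smul, Matrix.trace_smul, smul_eq_mul,
    show (O i)ᵀ * O i = 1 from hO.1 i]
  linarith

lemma IsTraceSumSolution.isSymm_and_rowBlock_eq_mul (hO : IsTraceSumSolution S O)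
    (hS : S.IsSymm) (i : Fin m) :
    ((O i)ᵀ * rowBlock (S * stack O) i).IsSymm ∧
      rowBlock (S * stack O) i = O i * ((O i)ᵀ * rowBlock (S * stack O) i) := by
  obtain ⟨hsymm, heq⟩ := isSymm_and_eq_mul_of_isMax (hO.1 i) fun _ hA =>
    hO.trace_transpose_mul_add_smul_le hS (posSemidef_add_opNorm_smul_one hS) i hA
  rw [Matrix.mul_add, Matrix.mul_smul, show (O i)ᵀ * O i = 1 from hO.1 i] at hsymm heq
  rw [Matrix.mul_add, Matrix.mul_smul, Matrix.mul_one] at heq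
  exact ⟨by simpa using hsymm.sub (Matrix.isSymm_one.smul (opNorm S)), add_right_cancel heq⟩

lemma stack_mul_right_mul_transpose (O : (i : Fin m) → Matrix (Fin (d i)) (Fin r) ℝ)
    {Q : Matrix (Fin r) (Fin r) ℝ} (hQ : Qᵀ * Q = 1) :
    stack (fun i => O i * Q) * (stack fun i => O i * Q)ᵀ = stack O * (stack O)ᵀ := by
  change stack O * Q * (stack O * Q)ᵀ = _
  rw [Matrix.transpose_mul, Matrix.mul_assoc, ← Matrix.mul_assoc Q, mul_eq_one_comm.1 hQ,
    Matrix.one_mul]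

lemma traceSum_eq_trace_mul (S : Matrix (Idx d) (Idx d) ℝ)
    (O : (i : Fin m) → Matrix (Fin (d i)) (Fin r) ℝ) :
    traceSum S O = (S * (stack O * (stack O)ᵀ)).trace := by
  rw [traceSum_eq_trace, trace_mul_mul_transpose]

lemma IsTraceSumSolution.mul_right (hO : IsTraceSumSolution S O) {Q : Matrix (Fin r) (Fin r) ℝ}
    (hQ : Qᵀ * Q = 1) : IsTraceSumSolution S fun i => O i * Q := by
  refine ⟨fun i => mul_orthogonal_mem_stiefel (hO.1 i) hQ, fun O' hO' => ?_⟩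
  rw [traceSum_eq_trace_mul S fun i => O i * Q, stack_mul_right_mul_transpose O hQ,
    ← traceSum_eq_trace_mul]
  exact hO.2 O' hO'

lemma exists_isTraceSumSolution (h : ∀ i, (stiefel (d i) r).Nonempty)
    (S : Matrix (Idx d) (Idx d) ℝ) :
    ∃ O : (i : Fin m) → Matrix (Fin (d i)) (Fin r) ℝ, IsTraceSumSolution S O := by
  obtain ⟨O, hO, hmax⟩ := (isCompact_univ_pi fun i : Fin m =>
    isCompact_stiefel (n := d i) (r := r)).exists_isMaxOn (Set.univ_pi_nonempty_iff.2 h)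
    (f := fun O => traceSum S O) (by unfold traceSum; fun_prop)
  exact ⟨O, fun i => hO i trivial, fun O' hO' => hmax fun i _ => hO' i⟩

lemma exists_isTraceSumSolution_posSemidef (h : ∀ i, (stiefel (d i) r).Nonempty)
    (S : Matrix (Idx d) (Idx d) ℝ) (T : Matrix (Idx d) (Fin r) ℝ) :
    ∃ O : (i : Fin m) → Matrix (Fin (d i)) (Fin r) ℝ,
      IsTraceSumSolution S O ∧ (Tᵀ * stack O).PosSemidef := by
  obtain ⟨O, hO⟩ := exists_isTraceSumSolution h S
  obtain ⟨Q, hQ, hpos⟩ := exists_orthogonal_posSemidef ((stack O)ᵀ * T)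
  refine ⟨fun i => O i * Q, hO.mul_right hQ, ?_⟩
  change (Tᵀ * (stack O * Q)).PosSemidef
  simpa [Matrix.mul_assoc] using hpos.transpose

end TraceSumSolution

section Tightness

variable {m r : ℕ} {d : Fin m → ℕ} {O : (i : Fin m) → Matrix (Fin (d i)) (Fin r) ℝ}
  {S : Matrix (Idx d) (Idx d) ℝ}

lemma isRankSolution_iff_of_unique (hm : 0 < m) (hS : S.IsSymm)
    (hO : ∀ i, O i ∈ stiefel (d i) r)
    (huniq : ∀ U, IsSDPSolution r S U ↔ U = stack O * (stack O)ᵀ) (U : Matrix (Idx d) (Idx d) ℝ) :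
    IsSDPSolution r S U ↔ IsRankSolution r S U := by
  obtain ⟨hmem, hmax⟩ := (huniq _).2 rfl
  rw [hS.eq] at hmax
  constructor
  · intro hU
    obtain rfl := (huniq U).1 hU
    exact ⟨⟨hmem, rank_stack_mul_transpose hm hO⟩, fun U' hU' _ => hmax U' hU'⟩
  · rintro ⟨⟨hU, -⟩, hUmax⟩
    refine ⟨hU, fun U' hU' => ?_⟩
    rw [hS.eq]
    exact (hmax U' hU').trans (hUmax _ hmem (rank_stack_mul_transpose hm hO))

lemma isSDPSolution_iff_exists_of_unique (hS : S.IsSymm) (hO : ∀ i, O i ∈ stiefel (d i) r)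
    (huniq : ∀ U, IsSDPSolution r S U ↔ U = stack O * (stack O)ᵀ) (U : Matrix (Idx d) (Idx d) ℝ) :
    IsSDPSolution r S U ↔ ∃ O' : (i : Fin m) → Matrix (Fin (d i)) (Fin r) ℝ,
      IsTraceSumSolution S O' ∧ U = stack O' * (stack O')ᵀ := by
  obtain ⟨-, hmax⟩ := (huniq _).2 rfl
  rw [hS.eq] at hmax
  constructor
  · intro hU
    refine ⟨O, ⟨hO, fun O' hO' => ?_⟩, (huniq U).1 hU⟩
    rw [traceSum_eq_trace_mul, traceSum_eq_trace_mul]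
    exact hmax _ (stack_mul_transpose_mem_sdpFeasible hO')
  · rintro ⟨O', hO', rfl⟩
    refine ⟨stack_mul_transpose_mem_sdpFeasible hO'.1, fun U' hU' => ?_⟩
    rw [hS.eq, ← traceSum_eq_trace_mul]
    exact (hmax U' hU').trans (traceSum_eq_trace_mul S O ▸ hO'.2 O hO)

end Tightness

lemma mul_le_of_mul_sq_le_mul {a b x : ℝ} (hx : 0 ≤ x) (hb : 0 ≤ b) (h : a * x ^ 2 ≤ b * x) :
    a * x ≤ b := by
  rcases hx.eq_or_lt with rfl | hx
  · simpa using hb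
  · exact le_of_mul_le_mul_right (by linarith) hx

section GlobalError

variable {m r : ℕ} {d : Fin m → ℕ} {Θ O : (i : Fin m) → Matrix (Fin (d i)) (Fin r) ℝ}
  {W : Matrix (Idx d) (Idx d) ℝ}

lemma isSymm_dataMatrix (hW : W.IsSymm) : (dataMatrix Θ W).IsSymm := by
  rw [dataMatrix_eq]
  exact (show (stack Θ * (stack Θ)ᵀ).IsSymm by simp [Matrix.IsSymm]).add hW

lemma trace_transpose_mul_dataMatrix_mul {l : Type} [Fintype l] (X : Matrix (Idx d) l ℝ) :
    (Xᵀ * (dataMatrix Θ W * X)).trace =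
      frobNorm ((stack Θ)ᵀ * X) ^ 2 + (Xᵀ * (W * X)).trace := by
  rw [dataMatrix_eq, ← trace_transpose_mul_self, ← Matrix.trace_add]
  congr 1
  simp only [Matrix.transpose_mul, Matrix.transpose_transpose, Matrix.add_mul, Matrix.mul_add,
    Matrix.mul_assoc]

lemma rowBlock_dataMatrix_mul (Y : Matrix (Idx d) (Fin r) ℝ) (i : Fin m) :
    rowBlock (dataMatrix Θ W * Y) i = Θ i * ((stack Θ)ᵀ * Y) + rowBlock (W * Y) i := by
  rw [dataMatrix_eq, Matrix.add_mul, Matrix.mul_assoc]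
  rfl

lemma posSemidef_dataMatrix_add_opNorm_smul_one (hW : W.IsSymm) :
    (dataMatrix Θ W + opNorm W • 1).PosSemidef := by
  rw [dataMatrix_eq, add_assoc]
  exact (posSemidef_mul_transpose_self _).add (posSemidef_add_opNorm_smul_one hW)

lemma frobNorm_stack (hO : ∀ i, O i ∈ stiefel (d i) r) :
    frobNorm (stack O) = m * √((r : ℝ) / m) := by
  rw [← sq_eq_sq₀ (frobNorm_nonneg _) (by positivity), sq_frobNorm_stack hO, mul_pow,
    Real.sq_sqrt (by positivity)]
  rcases eq_or_ne (m : ℝ) 0 with hm | hm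
  · simp [hm]
  · field_simp

lemma IsTraceSumSolution.frobNorm_stack_sub_le (hm : 0 < m) (hW : W.IsSymm)
    (hΘ : ∀ i, Θ i ∈ stiefel (d i) r) (hO : IsTraceSumSolution (dataMatrix Θ W) O)
    (hP : ((stack Θ)ᵀ * stack O).PosSemidef) :
    frobNorm (stack O - stack Θ) ≤ 4 * opNorm W * √((r : ℝ) / m) := by
  have hopt := hO.2 Θ hΘ
  rw [traceSum_eq_trace, traceSum_eq_trace, trace_transpose_mul_dataMatrix_mul,
    trace_transpose_mul_dataMatrix_mul] at hopt
  have hsignal := sq_frobNorm_transpose_mul_le (stack_transpose_mul_self hΘ)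
    (stack_transpose_mul_self hO.1) hP
  have hnoise := trace_transpose_mul_mul_sub_le hW (stack Θ) (stack O)
  rw [frobNorm_stack hΘ, frobNorm_stack hO.1] at hnoise
  have hmul : (m : ℝ) * frobNorm (stack O - stack Θ) ≤
      m * (4 * opNorm W * √((r : ℝ) / m)) :=
    mul_le_of_mul_sq_le_mul (frobNorm_nonneg _)
      (by have := opNorm_nonneg W; positivity) (by linarith)
  exact le_of_mul_le_mul_left hmul (Nat.cast_pos.2 hm)

lemma le_iSup_frobNorm_rowBlock (Y : Matrix (Idx d) (Fin r) ℝ) (i : Fin m) :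
    frobNorm (rowBlock Y i) ≤ ⨆ i, frobNorm (rowBlock Y i) :=
  le_ciSup (f := fun i => frobNorm (rowBlock Y i)) (Set.finite_range _).bddAbove i

lemma noiseTerm_nonneg : 0 ≤ noiseTerm Θ W :=
  add_nonneg (Real.iSup_nonneg fun _ => frobNorm_nonneg _) (by positivity)

lemma frobNorm_rowBlock_mul_stack_le_noiseTerm
    (hE : frobNorm (stack O - stack Θ) ≤ 4 * opNorm W * √((r : ℝ) / m)) (i : Fin m) :
    frobNorm (rowBlock (W * stack O) i) ≤ noiseTerm Θ W := by
  have hsplit : rowBlock (W * stack O) i =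
      rowBlock (W * stack Θ) i + rowBlock (W * (stack O - stack Θ)) i := by
    change _ = rowBlock (W * stack Θ + W * (stack O - stack Θ)) i
    rw [← Matrix.mul_add, add_sub_cancel]
  calc frobNorm (rowBlock (W * stack O) i)
      ≤ frobNorm (rowBlock (W * stack Θ) i) +
          frobNorm (rowBlock (W * (stack O - stack Θ)) i) := hsplit ▸ frobNorm_add_le _ _
    _ ≤ (⨆ i, frobNorm (rowBlock (W * stack Θ) i)) +
          opNorm W * frobNorm (stack O - stack Θ) :=
        add_le_add (le_iSup_frobNorm_rowBlock _ i)
          ((frobNorm_rowBlock_le _ i).trans (frobNorm_mul_le_opNorm_mul W _))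
    _ ≤ (⨆ i, frobNorm (rowBlock (W * stack Θ) i)) +
          opNorm W * (4 * opNorm W * √((r : ℝ) / m)) :=
        add_le_add_right (mul_le_mul_of_nonneg_left hE (opNorm_nonneg W)) _
    _ = noiseTerm Θ W := by rw [noiseTerm]; ring

end GlobalError

section BlockError

variable {m r : ℕ} {d : Fin m → ℕ} {Θ O : (i : Fin m) → Matrix (Fin (d i)) (Fin r) ℝ}
  {W : Matrix (Idx d) (Idx d) ℝ}

lemma IsTraceSumSolution.mul_frobNorm_sub_le (hW : W.IsSymm)
    (hΘ : ∀ i, Θ i ∈ stiefel (d i) r) (hO : IsTraceSumSolution (dataMatrix Θ W) O)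
    (hP : ((stack Θ)ᵀ * stack O).IsSymm) (i : Fin m) :
    (m - frobNorm (stack O - stack Θ) ^ 2 / 2 - opNorm W) * frobNorm (O i - Θ i) ≤
      2 * frobNorm (rowBlock (W * stack O) i) := by
  rw [frobNorm_sub_rev (O i)]
  have hopt := hO.two_mul_trace_sub_le (isSymm_dataMatrix hW)
    (posSemidef_dataMatrix_add_opNorm_smul_one hW) i (hΘ i)
  rw [rowBlock_dataMatrix_mul, Matrix.mul_add, Matrix.trace_add, mul_add,
    ← trace_transpose_mul_self_mul_of_mem_stiefel (hΘ i) (hO.1 i) hP] at hopt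
  have hsignal := mul_sq_frobNorm_le_trace_transpose_mul_self_mul hP
    (frobNorm_transpose_mul_sub_smul_one_le (stack_transpose_mul_self hΘ)
      (stack_transpose_mul_self hO.1) hP) (Θ i - O i)
  have hnoise := neg_le_of_abs_le
    (abs_trace_transpose_mul_le (Θ i - O i) (rowBlock (W * stack O) i))
  exact mul_le_of_mul_sq_le_mul (frobNorm_nonneg _)
    (mul_nonneg zero_le_two (frobNorm_nonneg _)) (by linarith)

lemma sq_frobNorm_stack_sub_le {δ : ℝ} (hδ : ∀ i, frobNorm (O i - Θ i) ≤ δ) :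
    frobNorm (stack O - stack Θ) ^ 2 ≤ m * δ ^ 2 := by
  rw [sq_frobNorm_eq_sum_rowBlock]
  calc ∑ i, frobNorm (rowBlock (stack O - stack Θ) i) ^ 2 ≤ ∑ _i : Fin m, δ ^ 2 :=
        Finset.sum_le_sum fun i _ => pow_le_pow_left₀ (frobNorm_nonneg _) (hδ i) 2
    _ = m * δ ^ 2 := by simp

/-- The bound `2 A / (m - ‖W‖ (4 √r + 1) - 1)`, with `A = noiseTerm Θ W`, on the distance between
corresponding blocks of `Θ` and of a solution of the trace-sum problem aligned with `Θ`. -/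
noncomputable def blockRadius (Θ : (i : Fin m) → Matrix (Fin (d i)) (Fin r) ℝ)
    (W : Matrix (Idx d) (Idx d) ℝ) : ℝ :=
  2 * noiseTerm Θ W / (m - opNorm W * (4 * √(r : ℝ) + 1) - 1)

lemma NoiseCondition.pos (h : NoiseCondition Θ W) : 0 < m := by
  have := opNorm_nonneg W
  exact Nat.cast_pos.1 (h.1.trans_le' (by positivity : (0 : ℝ) ≤ _))

lemma NoiseCondition.blockRadius_nonneg (h : NoiseCondition Θ W) : 0 ≤ blockRadius Θ W :=
  div_nonneg (mul_nonneg zero_le_two noiseTerm_nonneg) (by linarith [h.1])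

lemma NoiseCondition.sq_le_of_le (h : NoiseCondition Θ W) {ε : ℝ} (hε0 : 0 ≤ ε)
    (hε : ε ≤ 4 * opNorm W * √((r : ℝ) / m)) : ε ^ 2 ≤ 4 * opNorm W * √(r : ℝ) := by
  have hm : (0 : ℝ) < m := Nat.cast_pos.2 h.pos
  have hw : 4 * opNorm W * √(r : ℝ) ≤ m := by linarith [h.1, opNorm_nonneg W]
  have hw0 : 0 ≤ 4 * opNorm W * √(r : ℝ) := by have := opNorm_nonneg W; positivity
  calc ε ^ 2 ≤ (4 * opNorm W * √((r : ℝ) / m)) ^ 2 := pow_le_pow_left₀ hε0 hε 2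
    _ = 4 * opNorm W * √(r : ℝ) * (4 * opNorm W * √(r : ℝ)) / m := by
        rw [Real.sqrt_div (Nat.cast_nonneg r), mul_div_assoc', div_pow, Real.sq_sqrt hm.le, sq]
    _ ≤ 4 * opNorm W * √(r : ℝ) := div_le_of_le_mul₀ hm.le hw0
        (mul_le_mul_of_nonneg_left hw hw0)

lemma NoiseCondition.frobNorm_sub_le_blockRadius (h : NoiseCondition Θ W) (hW : W.IsSymm)
    (hΘ : ∀ i, Θ i ∈ stiefel (d i) r) (hO : IsTraceSumSolution (dataMatrix Θ W) O)
    (hP : ((stack Θ)ᵀ * stack O).PosSemidef) (i : Fin m) :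
    frobNorm (O i - Θ i) ≤ blockRadius Θ W := by
  have hE := hO.frobNorm_stack_sub_le h.pos hW hΘ hP
  have hE_sq := h.sq_le_of_le (frobNorm_nonneg _) hE
  rw [blockRadius, le_div_iff₀ (by linarith [h.1])]
  have hden : (m : ℝ) - opNorm W * (4 * √(r : ℝ) + 1) - 1 ≤
      m - frobNorm (stack O - stack Θ) ^ 2 / 2 - opNorm W := by
    linarith [sq_nonneg (frobNorm (stack O - stack Θ))]
  calc frobNorm (O i - Θ i) * (m - opNorm W * (4 * √(r : ℝ) + 1) - 1)
      ≤ frobNorm (O i - Θ i) * (m - frobNorm (stack O - stack Θ) ^ 2 / 2 - opNorm W) :=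
        mul_le_mul_of_nonneg_left hden (frobNorm_nonneg _)
    _ ≤ 2 * frobNorm (rowBlock (W * stack O) i) := by
        rw [mul_comm]
        exact hO.mul_frobNorm_sub_le hW hΘ (Matrix.isHermitian_iff_isSymm.1 hP.1) i
    _ ≤ 2 * noiseTerm Θ W := mul_le_mul_of_nonneg_left
        (frobNorm_rowBlock_mul_stack_le_noiseTerm hE i) zero_le_two

end BlockError

section UniqueSolution

variable {m r : ℕ} {d : Fin m → ℕ} {Θ O : (i : Fin m) → Matrix (Fin (d i)) (Fin r) ℝ}
  {W : Matrix (Idx d) (Idx d) ℝ}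

lemma trace_transpose_mul_dataMatrix_mul_le {l : Type} [Fintype l] {Z : Matrix (Idx d) l ℝ}
    (hZ : (stack O)ᵀ * Z = 0) :
    (Zᵀ * (dataMatrix Θ W * Z)).trace ≤
      (frobNorm (stack O - stack Θ) ^ 2 + opNorm W) * frobNorm Z ^ 2 := by
  have hsignal : frobNorm ((stack Θ)ᵀ * Z) ≤ frobNorm (stack O - stack Θ) * frobNorm Z := by
    have hΘZ : (stack Θ)ᵀ * Z = (stack Θ - stack O)ᵀ * Z := by
      rw [Matrix.transpose_sub, Matrix.sub_mul, hZ, sub_zero]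
    rw [hΘZ, frobNorm_sub_rev, ← frobNorm_transpose (stack Θ - stack O)]
    exact frobNorm_mul_le _ _
  rw [trace_transpose_mul_dataMatrix_mul]
  linarith [pow_le_pow_left₀ (frobNorm_nonneg _) hsignal 2, trace_transpose_mul_mul_le W Z Z]

lemma NoiseCondition.sq_add_opNorm_lt (h : NoiseCondition Θ W) {ε : ℝ}
    (hε : ε ^ 2 ≤ m * blockRadius Θ W ^ 2) :
    ε ^ 2 + opNorm W <
      m - (ε ^ 2 / 2 + blockRadius Θ W * (m + ε ^ 2 / 2) + noiseTerm Θ W) := by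
  have hsmall : 4 * m * blockRadius Θ W + 2 * noiseTerm Θ W + 2 * opNorm W < m := by
    have hsqrt : 0 ≤ 8 * opNorm W * √((r : ℝ) / m) := by
      have := opNorm_nonneg W
      positivity
    have := h.2
    rw [← blockRadius] at this
    linarith
  have hm : (0 : ℝ) < m := Nat.cast_pos.2 h.pos
  have hδ0 := h.blockRadius_nonneg
  have hA0 : 0 ≤ noiseTerm Θ W := noiseTerm_nonneg
  have hw0 := opNorm_nonneg W
  have hmδ : m * blockRadius Θ W ≤ m * (1 / 4) := by linarith
  have hδ : blockRadius Θ W ≤ 1 / 4 := le_of_mul_le_mul_left hmδ hm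
  have hε_le : ε ^ 2 ≤ m * blockRadius Θ W * (1 / 4) := by
    rw [sq (blockRadius Θ W), ← mul_assoc] at hε
    exact hε.trans (mul_le_mul_of_nonneg_left hδ (mul_nonneg hm.le hδ0))
  have hδε : blockRadius Θ W * (ε ^ 2 / 2) ≤ 1 / 4 * (ε ^ 2 / 2) :=
    mul_le_mul_of_nonneg_right hδ (by positivity)
  linarith [mul_nonneg hm.le hδ0]

theorem NoiseCondition.exists_isSDPSolution_iff (h : NoiseCondition Θ W) (hW : W.IsSymm)
    (hΘ : ∀ i, Θ i ∈ stiefel (d i) r) :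
    ∃ O : (i : Fin m) → Matrix (Fin (d i)) (Fin r) ℝ, (∀ i, O i ∈ stiefel (d i) r) ∧
      ∀ U, IsSDPSolution r (dataMatrix Θ W) U ↔ U = stack O * (stack O)ᵀ := by
  have hS : (dataMatrix Θ W).IsSymm := isSymm_dataMatrix hW
  obtain ⟨O, hO, hP⟩ := exists_isTraceSumSolution_posSemidef (fun i => ⟨Θ i, hΘ i⟩)
    (dataMatrix Θ W) (stack Θ)
  have hblock := h.frobNorm_sub_le_blockRadius hW hΘ hO hP
  have hnoise := frobNorm_rowBlock_mul_stack_le_noiseTerm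
    (hO.frobNorm_stack_sub_le h.pos hW hΘ hP)
  have hlt := h.sq_add_opNorm_lt (sq_frobNorm_stack_sub_le hblock)
  set η := frobNorm (stack O - stack Θ) ^ 2 / 2
  set t := m - (η + blockRadius Θ W * (m + η) + noiseTerm Θ W)
  refine ⟨O, hO.1, isSDPSolution_iff_eq_stack_of_dualCertificate (t := t)
    (M := fun i => (O i)ᵀ * rowBlock (dataMatrix Θ W * stack O) i - t • 1) h.pos hS hO.1
    (fun i => ?_) (fun i => ?_) fun Z hZ hne => ?_⟩
  · refine posSemidef_sub_smul_one_of_frobNorm_sub_le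
      (hO.isSymm_and_rowBlock_eq_mul hS i).1 (c := m) ?_
    have hη := frobNorm_transpose_mul_sub_smul_one_le (stack_transpose_mul_self hΘ)
      (stack_transpose_mul_self hO.1) (Matrix.isHermitian_iff_isSymm.1 hP.1)
    rw [rowBlock_dataMatrix_mul, sub_sub_cancel]
    exact (frobNorm_transpose_mul_add_sub_smul_one_le (hO.1 i) (Θ i) _ m.cast_nonneg hη).trans
      (add_le_add (add_le_add_right (mul_le_mul_of_nonneg_right (hblock i) (by positivity)) η)
        (hnoise i))
  · rw [sub_add_cancel]
    exact (hO.isSymm_and_rowBlock_eq_mul hS i).2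
  · have hZ_pos : 0 < frobNorm Z := (frobNorm_nonneg Z).lt_of_ne' (frobNorm_eq_zero.not.2 hne)
    exact (trace_transpose_mul_dataMatrix_mul_le hZ).trans_lt
      (mul_lt_mul_of_pos_right hlt (pow_pos hZ_pos 2))

end UniqueSolution

section DiscordantNoise

variable {m r : ℕ} {d : Fin m → ℕ} {Θ : (i : Fin m) → Matrix (Fin (d i)) (Fin r) ℝ}
  {W : Matrix (Idx d) (Idx d) ℝ} {u σ : ℝ}

lemma sqrt_pow_four (u : ℝ) : √(u ^ 4) = u ^ 2 := by
  rw [show u ^ 4 = (u ^ 2) ^ 2 by ring, Real.sqrt_sq (sq_nonneg u)]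

lemma sqrt_log_pow_four_le (hu : 0 < u) : √(Real.log (u ^ 4)) ≤ 0.86 * u := by
  -- The tangent line of `log` at `e` gives `log (u ^ 2) ≤ u ^ 2 / e`, and `2 / e ≤ 0.86 ^ 2`.
  have hlog : Real.log (u ^ 2 / Real.exp 1) ≤ u ^ 2 / Real.exp 1 - 1 :=
    Real.log_le_sub_one_of_pos (by positivity)
  rw [Real.log_div (by positivity) (Real.exp_ne_zero 1), Real.log_exp, Real.log_pow] at hlog
  have hexp : u ^ 2 / Real.exp 1 ≤ 0.3698 * u ^ 2 := by
    rw [div_le_iff₀ (Real.exp_pos 1)]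
    nlinarith [Real.exp_one_gt_d9, sq_nonneg u]
  refine Real.sqrt_le_iff.2 ⟨by positivity, ?_⟩
  rw [Real.log_pow, mul_pow]
  push_cast at hlog ⊢
  linarith

lemma mul_sqrt_le_of_le_div {x : ℝ} (hu : 0 < u) (hσ_le : σ ≤ u / (60 * √(x / u ^ 4))) :
    σ * √x ≤ u ^ 3 / 60 := by
  have hsqrt : √(x / u ^ 4) = √x / u ^ 2 := by
    rw [Real.sqrt_div' _ (by positivity), sqrt_pow_four]
  rcases (Real.sqrt_nonneg x).eq_or_lt with h0 | h0
  · rw [← h0, mul_zero]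
    positivity
  · rw [hsqrt, le_div_iff₀ (by positivity)] at hσ_le
    calc σ * √x = σ * (60 * (√x / u ^ 2)) * (u ^ 2 / 60) := by field_simp
      _ ≤ u * (u ^ 2 / 60) := mul_le_mul_of_nonneg_right hσ_le (by positivity)
      _ = u ^ 3 / 60 := by ring

lemma iSup_frobNorm_rowBlock_smul {c : ℝ} (hc : 0 ≤ c) (Y : Matrix (Idx d) (Fin r) ℝ) :
    ⨆ i, frobNorm (rowBlock (c • Y) i) = c * ⨆ i, frobNorm (rowBlock Y i) := by
  have hsmul : ∀ i, frobNorm (rowBlock (c • Y) i) = c * frobNorm (rowBlock Y i) := fun i => by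
    rw [← abs_of_nonneg hc, ← frobNorm_smul, abs_of_nonneg hc]
    rfl
  simp only [hsmul, Real.mul_iSup_of_nonneg hc]

lemma IsDiscordant.opNorm_le_of_inv_smul (hσ : 0 < σ) (hW : IsDiscordant Θ (σ⁻¹ • W)) :
    opNorm W ≤ σ * (3 * √((∑ i, d i : ℕ) : ℝ)) := by
  have h := hW.opNorm_le
  rwa [opNorm_smul, abs_of_pos (inv_pos.2 hσ), inv_mul_le_iff₀ hσ] at h

lemma IsDiscordant.iSup_frobNorm_le_of_inv_smul (hσ : 0 < σ) (hW : IsDiscordant Θ (σ⁻¹ • W)) :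
    ⨆ i, frobNorm (rowBlock (W * stack Θ) i) ≤
      σ * (3 * √(((∑ i, d i : ℕ) : ℝ) * r * Real.log m)) := by
  have h := hW.sup_frobNorm_le
  rwa [Matrix.smul_mul, iSup_frobNorm_rowBlock_smul (inv_pos.2 hσ).le, inv_mul_le_iff₀ hσ] at h

lemma noiseTerm_le (hu : 0 < u) (hum : u ^ 4 = m) (hr : 1 ≤ r)
    (hw : opNorm W * √(r : ℝ) ≤ u ^ 3 / 20)
    (hsup : ⨆ i, frobNorm (rowBlock (W * stack Θ) i) ≤ 0.043 * u ^ 4) :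
    noiseTerm Θ W ≤ 0.053 * u ^ 4 := by
  have hw0 := opNorm_nonneg W
  have hr1 : 1 ≤ √(r : ℝ) := Real.one_le_sqrt.2 (Nat.one_le_cast.2 hr)
  have hquad : 4 * opNorm W ^ 2 * √((r : ℝ) / m) ≤ 0.01 * u ^ 4 :=
    calc 4 * opNorm W ^ 2 * √((r : ℝ) / m) = 4 * (opNorm W ^ 2 * √(r : ℝ)) / u ^ 2 := by
          rw [Real.sqrt_div (Nat.cast_nonneg r), ← hum, sqrt_pow_four]
          ring
      _ ≤ 4 * (opNorm W * √(r : ℝ)) ^ 2 / u ^ 2 := by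
          rw [mul_pow]
          gcongr
          exact le_self_pow₀ hr1 two_ne_zero
      _ ≤ 4 * (u ^ 3 / 20) ^ 2 / u ^ 2 := by gcongr
      _ = 0.01 * u ^ 4 := by field_simp; norm_num
  rw [noiseTerm]
  linarith

lemma noiseCondition_of_le (hu : 0 < u) (hum : u ^ 4 = m) (hm : 5 ≤ m) (hr : 1 ≤ r)
    (hw : opNorm W * √(r : ℝ) ≤ u ^ 3 / 20) (hA : noiseTerm Θ W ≤ 0.053 * u ^ 4) :
    NoiseCondition Θ W := by
  have hm5 : (5 : ℝ) ≤ u ^ 4 := by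
    rw [hum]
    exact_mod_cast hm
  have hu_ge : 1.495 ≤ u := by
    refine (pow_le_pow_iff_left₀ (by norm_num) hu.le four_ne_zero).1 (hm5.trans' ?_)
    norm_num
  have hu3 : 1.495 * u ^ 3 ≤ u ^ 4 := by
    rw [pow_succ' u 3]
    exact mul_le_mul_of_nonneg_right hu_ge (by positivity)
  have hu1 : 3.3 * u ≤ u ^ 4 := by
    rw [pow_succ u 3]
    refine mul_le_mul_of_nonneg_right ?_ hu.le
    exact (pow_le_pow_left₀ (by norm_num) hu_ge 3).trans' (by norm_num)
  have hw_le : opNorm W ≤ u ^ 3 / 20 := (le_mul_of_one_le_right (opNorm_nonneg W)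
    (Real.one_le_sqrt.2 (Nat.one_le_cast.2 hr))).trans hw
  have hden : 0.632 * (m : ℝ) ≤ m - opNorm W * (4 * √(r : ℝ) + 1) - 1 := by
    rw [← hum]
    linarith
  refine ⟨by linarith [hden], ?_⟩
  have hquot : 2 * noiseTerm Θ W / (m - opNorm W * (4 * √(r : ℝ) + 1) - 1) ≤ 0.168 := by
    rw [div_le_iff₀ (by linarith)]
    linarith
  have hsqrt : 8 * opNorm W * √((r : ℝ) / m) ≤ 0.4 * u :=
    calc 8 * opNorm W * √((r : ℝ) / m) = 8 * (opNorm W * √(r : ℝ)) / u ^ 2 := by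
          rw [Real.sqrt_div (Nat.cast_nonneg r), ← hum, sqrt_pow_four]
          ring
      _ ≤ 8 * (u ^ 3 / 20) / u ^ 2 := by gcongr
      _ = 0.4 * u := by field_simp; norm_num
  linarith [mul_le_mul_of_nonneg_left hquot (by positivity : (0 : ℝ) ≤ 4 * m)]

theorem noiseCondition_of_isDiscordant (hm : 5 ≤ m) (hr : 1 ≤ r) (hσ : 0 < σ)
    (hW : IsDiscordant Θ (σ⁻¹ • W))
    (hσ_le : σ ≤ (m : ℝ) ^ (1 / 4 : ℝ) / (60 * √(((∑ i, d i : ℕ) : ℝ) / m * r))) :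
    NoiseCondition Θ W := by
  set u := (m : ℝ) ^ (1 / 4 : ℝ)
  set D : ℝ := ((∑ i, d i : ℕ) : ℝ)
  have hD : 0 ≤ D := Nat.cast_nonneg _
  have hu : 0 < u := Real.rpow_pos_of_pos (Nat.cast_pos.2 (by omega)) _
  have hum : u ^ 4 = m := by
    rw [← Real.rpow_natCast, ← Real.rpow_mul (Nat.cast_nonneg m)]
    norm_num
  rw [div_mul_eq_mul_div, ← hum] at hσ_le
  have hσD := mul_sqrt_le_of_le_div hu hσ_le
  have hw : opNorm W * √(r : ℝ) ≤ u ^ 3 / 20 :=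
    calc opNorm W * √(r : ℝ) ≤ σ * (3 * √D) * √(r : ℝ) :=
          mul_le_mul_of_nonneg_right (hW.opNorm_le_of_inv_smul hσ) (Real.sqrt_nonneg _)
      _ = 3 * (σ * √(D * r)) := by rw [Real.sqrt_mul hD]; ring
      _ ≤ u ^ 3 / 20 := by linarith
  have hsup : ⨆ i, frobNorm (rowBlock (W * stack Θ) i) ≤ 0.043 * u ^ 4 :=
    calc ⨆ i, frobNorm (rowBlock (W * stack Θ) i) ≤ σ * (3 * √(D * r * Real.log m)) :=
          hW.iSup_frobNorm_le_of_inv_smul hσ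
      _ = 3 * (σ * √(D * r)) * √(Real.log m) := by rw [Real.sqrt_mul (by positivity)]; ring
      _ ≤ 3 * (u ^ 3 / 60) * (0.86 * u) := by
          gcongr
          exact hum ▸ sqrt_log_pow_four_le hu
      _ = 0.043 * u ^ 4 := by ring
  exact noiseCondition_of_le hu hum hm hr hw (noiseTerm_le hu hum hr hw hsup)

end DiscordantNoise

end OTSM

theorem mainTheorem5_general (m r : ℕ) (hm : 5 ≤ m) (hr : 1 ≤ r) (d : Fin m → ℕ)
    (Θ : (i : Fin m) → Matrix (Fin (d i)) (Fin r) ℝ)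
    (hΘ : ∀ i, Θ i ∈ OTSM.stiefel (d i) r)
    (W : Matrix (OTSM.Idx d) (OTSM.Idx d) ℝ)
    (σ : ℝ) (hσ : 0 < σ)
    (hW : OTSM.IsDiscordant Θ (σ⁻¹ • W))
    (hσ_le : σ ≤ (m : ℝ) ^ (1 / 4 : ℝ) / (60 * √(((∑ i, d i : ℕ) : ℝ) / m * r))) :
    OTSM.NoiseCondition Θ W ∧
    (∀ U : Matrix (OTSM.Idx d) (OTSM.Idx d) ℝ,
      OTSM.IsSDPSolution r (OTSM.dataMatrix Θ W) U ↔
        OTSM.IsRankSolution r (OTSM.dataMatrix Θ W) U) ∧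
    (∀ U : Matrix (OTSM.Idx d) (OTSM.Idx d) ℝ,
      OTSM.IsSDPSolution r (OTSM.dataMatrix Θ W) U ↔
        ∃ O : (i : Fin m) → Matrix (Fin (d i)) (Fin r) ℝ,
          OTSM.IsTraceSumSolution (OTSM.dataMatrix Θ W) O ∧
            U = OTSM.stack O * (OTSM.stack O)ᵀ) := by
  have hnoise := OTSM.noiseCondition_of_isDiscordant hm hr hσ hW hσ_le
  have hW_symm : W.IsSymm := by
    simpa [smul_smul, hσ.ne'] using hW.symm.smul σ
  have hS := OTSM.isSymm_dataMatrix (Θ := Θ) hW_symm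
  obtain ⟨O, hO, huniq⟩ := hnoise.exists_isSDPSolution_iff hW_symm hΘ
  exact ⟨hnoise, OTSM.isRankSolution_iff_of_unique hnoise.pos hS hO huniq,
    OTSM.isSDPSolution_iff_exists_of_unique hS hO huniq⟩

theorem mainTheorem5 (m r : ℕ) (hm : 8 ≤ m) (hr : 1 ≤ r) (d : Fin m → ℕ)
    (Θ : (i : Fin m) → Matrix (Fin (d i)) (Fin r) ℝ)
    (hΘ : ∀ i, Θ i ∈ OTSM.stiefel (d i) r)
    (W : Matrix (OTSM.Idx d) (OTSM.Idx d) ℝ)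
    (σ : ℝ) (hσ : 0 < σ)
    (hW : OTSM.IsDiscordant Θ (σ⁻¹ • W))
    (hσ_le : σ ≤ (m : ℝ) ^ (1 / 4 : ℝ) / (60 * √(((∑ i, d i : ℕ) : ℝ) / m * r))) :
    OTSM.NoiseCondition Θ W ∧
    (∀ U : Matrix (OTSM.Idx d) (OTSM.Idx d) ℝ,
      OTSM.IsSDPSolution r (OTSM.dataMatrix Θ W) U ↔
        OTSM.IsRankSolution r (OTSM.dataMatrix Θ W) U) ∧
    (∀ U : Matrix (OTSM.Idx d) (OTSM.Idx d) ℝ,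
      OTSM.IsSDPSolution r (OTSM.dataMatrix Θ W) U ↔
        ∃ O : (i : Fin m) → Matrix (Fin (d i)) (Fin r) ℝ,
          OTSM.IsTraceSumSolution (OTSM.dataMatrix Θ W) O ∧
            U = OTSM.stack O * (OTSM.stack O)ᵀ) :=
  mainTheorem5_general m r (by omega) hr d Θ hΘ W σ hσ hW hσ_le
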